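/- Let $H$ be a complex Hilbert space. A function $Q:D(Q)\to L(H)$ belongs to $N_\kappa(H)$ if it is meromorphic in $\mathbb C\setminus\mathbb R$, $Q(\bar z)^*=Q(z)$ on $D(Q)$, and the kernel $N_Q(z,w)=\frac{Q(z)-Q(w)^*}{z-\bar w}$, $z,w\in D(Q)\cap\mathbb C^+$, has exactly $\kappa$ negative squares. Let $Q\in N_\kappa(H)$ be given by a minimal representation $$Q(z)=Q(z_0)^*+(z-\bar z_0)\,\Gamma^+\bigl(I+(z-z_0)(A-z)^{-1}\bigr)\Gamma,\qquad z\in D(Q)\subseteq\rho(A),$$ where $A$ is a self-adjoint linear relation in a Pontryagin space $(K,[\cdot,\cdot])$, $\Gamma:H\to K$ is a bounded operator with adjoint $\Gamma^+:K\to H$, $(h,\Gamma^+k)=[\Gamma h,k]$, $z_0\in D(Q)\cap\mathbb C^+$, and minimality means that $K$ is the closed linear span of the vectors $(I+(z-z_0)(A-z)^{-1})\Gamma h$ with $z\in\rho(A)$, $h\in H$. Let $\alpha\in\mathbb R$ and let $X=\{x_0,\dots,x_{l-1}\}$ be a maximal non-degenerate Jordan chain of length $l\ge 1$ of $A$ at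 $\alpha$; that is, $x_0\neq0$, $(x_0,\alpha x_0)\in A$, $(x_k,\alpha x_k+x_{k-1})\in A$ for $1\le k\le l-1$, the chain cannot be continued by a vector $x_l$, and $[\cdot,\cdot]$ does not degenerate on $K_1:=\operatorname{span}X$. Let $E:K\to K_1$ be the $[\cdot,\cdot]$-orthogonal projection onto $K_1$, let $A_1$ be the operator in $K_1$ with graph $A\cap(K_1\times K_1)$ (it exists and is self-adjoint in $K_1$), and put $\Gamma_1:=(A_1-z_0)E\Gamma:H\to K_1$. Then: (i) $Q(z)=Q_1(z)+Q_2(z)$ for $z\in D(Q)$, where $Q_i\in N_{\kappa_i}(H)$, $i=1,2$, $\kappa_1+\kappa_2=\kappa$, $Q_1(z)=\Gamma_1^+(A_1-z)^{-1}\Gamma_1$ for all $z\ne\alpha$, and $\sigma(Q_1)=\sigma(A_1)=\{\alpha\}$, where $\sigma(Q_1)$ is the set of points of $\mathbb C$ to which $Q_1$ has no holomorphic continuation. (ii) The chain can be generated from the range of $\Gamma_1$: there is a vector $x'_{l-1}\in\Gamma_1(H)$ such that the vectors $x'_k:=(A_1-\alpha)^{l-1-k}x'_{l-1}$, $k=0,\dots,l-1$,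 form a maximal non-degenerate Jordan chain of $A$ at $\alpha$ with $x'_0=x_0$ and with the same linear span $K_1$ as $X$. The same holds with $E\Gamma(H)$ in place of $\Gamma_1(H)$. -/

import Mathlib

open scoped Topology ComplexConjugate

namespace GenNevanlinna

noncomputable section

/-- A fundamental symmetry `J = J* = J⁻¹` on a Hilbert space `K`. It turns `K` into a Krein space
with the indefinite scalar product `[x, y] = (J x, y)`; every Krein space arises in this way from
one of its fundamental decompositions, and its topology is that of the Hilbert space `K`. -/
structure KreinSymmetry (K : Type*) [NormedAddCommGroup K] [InnerProductSpace ℂ K]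
    [CompleteSpace K] where
  /-- The fundamental symmetry. -/
  J : K →L[ℂ] K
  isSelfAdjoint : IsSelfAdjoint J
  sq_eq_id : J ∘L J = ContinuousLinearMap.id ℂ K

section Krein

variable {H K : Type*} [NormedAddCommGroup H] [InnerProductSpace ℂ H] [CompleteSpace H]
  [NormedAddCommGroup K] [InnerProductSpace ℂ K] [CompleteSpace K]

/-- The indefinite scalar product `[x, y]`, linear in `x` and conjugate-linear in `y`. -/
def KreinSymmetry.form (P : KreinSymmetry K) (x y : K) : ℂ :=
  inner ℂ y (P.J x)

/-- The negative part `K₋ = ker (J + I)` of the fundamental decomposition. -/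
def KreinSymmetry.negPart (P : KreinSymmetry K) : Submodule ℂ K :=
  LinearMap.ker (P.J + ContinuousLinearMap.id ℂ K).toLinearMap

/-- `K` is a Pontryagin space: the indefinite scalar product has finitely many negative squares. -/
def KreinSymmetry.IsPontryagin (P : KreinSymmetry K) : Prop :=
  FiniteDimensional ℂ P.negPart

/-- The adjoint `Γ⁺ : K → H` of `Γ : H → K`, that is `(h, Γ⁺ k) = [Γ h, k]`. -/
def KreinSymmetry.plusAdjoint (P : KreinSymmetry K) (Γ : H →L[ℂ] K) : K →L[ℂ] H :=
  (ContinuousLinearMap.adjoint Γ) ∘L P.J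

theorem KreinSymmetry.form_apply_left (P : KreinSymmetry K) (Γ : H →L[ℂ] K) (h : H) (k : K) :
    inner ℂ (P.plusAdjoint Γ k) h = P.form (Γ h) k := by
  have hJ := (ContinuousLinearMap.isSelfAdjoint_iff_isSymmetric.mp P.isSelfAdjoint) k (Γ h)
  simp only [KreinSymmetry.plusAdjoint, KreinSymmetry.form, ContinuousLinearMap.comp_apply,
    ContinuousLinearMap.adjoint_inner_left]
  exact hJ

/-- The indefinite scalar product does not degenerate on the subspace `S`. -/
def KreinSymmetry.NondegenerateOn (P : KreinSymmetry K) (S : Submodule ℂ K) : Prop :=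
  ∀ u ∈ S, (∀ v ∈ S, P.form u v = 0) → u = 0

/-- `E` is the projection onto `S` that is orthogonal with respect to `[., .]`. -/
structure KreinSymmetry.IsOrthogonalProjection (P : KreinSymmetry K) (S : Submodule ℂ K)
    (E : K →L[ℂ] K) : Prop where
  idempotent : E ∘L E = E
  range_eq : LinearMap.range E.toLinearMap = S
  symmetric : ∀ x y, P.form (E x) y = P.form x (E y)

/-! ### Linear relations: a linear relation in `K` is a linear subspace of `K × K` -/

/-- `A` is self-adjoint: it equals `A^[*] = {(y, y') : [x', y] = [x, y'] for all (x, x') ∈ A}`. -/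
def KreinSymmetry.IsSelfAdjointRel (P : KreinSymmetry K) (A : Submodule ℂ (K × K)) : Prop :=
  ∀ p : K × K, p ∈ A ↔ ∀ q ∈ A, P.form q.2 p.1 = P.form q.1 p.2

/-- `R` is the inverse relation `(A - z)⁻¹ = {(y - z x, x) : (x, y) ∈ A}`, i.e. this relation is a
bounded operator, defined on the whole of `K`. -/
def IsResolventAt (A : Submodule ℂ (K × K)) (z : ℂ) (R : K →L[ℂ] K) : Prop :=
  ∀ f x : K, (x, f + z • x) ∈ A ↔ R f = x

/-- The resolvent set `ρ(A)`. -/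
def relResolventSet (A : Submodule ℂ (K × K)) : Set ℂ :=
  {z | ∃ R : K →L[ℂ] K, IsResolventAt A z R}

open Classical in
/-- The resolvent `(A - z)⁻¹` (set to `0` for `z ∉ ρ(A)`). -/
def relResolvent (A : Submodule ℂ (K × K)) (z : ℂ) : K →L[ℂ] K :=
  if h : ∃ R : K →L[ℂ] K, IsResolventAt A z R then h.choose else 0

theorem relResolvent_spec {A : Submodule ℂ (K × K)} {z : ℂ} (hz : z ∈ relResolventSet A) :
    IsResolventAt A z (relResolvent A z) := by
  have h : ∃ R : K →L[ℂ] K, IsResolventAt A z R := hz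
  rw [relResolvent, dif_pos h]
  exact h.choose_spec

/-- `Γ_z = (I + (z - z₀)(A - z)⁻¹) Γ`. -/
def gammaField (A : Submodule ℂ (K × K)) (z₀ : ℂ) (Γ : H →L[ℂ] K) (z : ℂ) : H →L[ℂ] K :=
  (ContinuousLinearMap.id ℂ K + (z - z₀) • relResolvent A z) ∘L Γ

/-- `Q(z) = Q(z₀)* + (z - conj z₀) Γ⁺ (I + (z - z₀)(A - z)⁻¹) Γ` for all `z` in the domain `D` of
`Q`, where `K` is a Pontryagin space, `A` is a self-adjoint linear relation in `K`, and
`z₀ ∈ ρ(A)` lies in the open upper half-plane. -/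
structure IsRepresentedBy (D : Set ℂ) (Q : ℂ → H →L[ℂ] H) (P : KreinSymmetry K)
    (A : Submodule ℂ (K × K)) (Γ : H →L[ℂ] K) (z₀ : ℂ) : Prop where
  isPontryagin : P.IsPontryagin
  isSelfAdjointRel : P.IsSelfAdjointRel A
  domain_subset : D ⊆ relResolventSet A
  base_mem : z₀ ∈ D
  base_im_pos : 0 < z₀.im
  eq_on : ∀ z ∈ D, Q z = ContinuousLinearMap.adjoint (Q z₀) +
    (z - conj z₀) • (P.plusAdjoint Γ ∘L gammaField A z₀ Γ z)

/-- Minimality: `K` is the closed linear span of the vectors `(I + (z - z₀)(A - z)⁻¹) Γ h`, with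
`z ∈ ρ(A)` and `h ∈ H`. -/
def IsMinimal (A : Submodule ℂ (K × K)) (Γ : H →L[ℂ] K) (z₀ : ℂ) : Prop :=
  (Submodule.span ℂ
    {y : K | ∃ z ∈ relResolventSet A, ∃ h : H, y = gammaField A z₀ Γ z h}).topologicalClosure = ⊤

/-! ### Jordan chains -/

/-- `x₀, …, x_{l-1}` is a Jordan chain of the linear relation `A` at `α`: `l ≥ 1`, `x₀ ≠ 0`,
`(x₀, α x₀) ∈ A`, and `(x_k, α x_k + x_{k-1}) ∈ A` for `1 ≤ k ≤ l - 1`. -/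
structure IsJordanChain (A : Submodule ℂ (K × K)) (α : ℂ) {l : ℕ} (x : Fin l → K) : Prop where
  length_pos : 0 < l
  eigenvector : ∀ k : Fin l, (k : ℕ) = 0 → x k ≠ 0 ∧ (x k, α • x k) ∈ A
  step : ∀ j k : Fin l, (k : ℕ) = (j : ℕ) + 1 → (x k, α • x k + x j) ∈ A

/-- A maximal non-degenerate Jordan chain: it cannot be continued to a longer chain, and the
indefinite scalar product does not degenerate on its linear span. -/
structure IsMaxNondegJordanChain (P : KreinSymmetry K) (A : Submodule ℂ (K × K)) (α : ℂ) {l : ℕ}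
    (x : Fin l → K) : Prop where
  isJordanChain : IsJordanChain A α x
  maximal : ∀ y : K, ¬ IsJordanChain A α (Fin.snoc (α := fun _ => K) x y)
  nondegenerate : P.NondegenerateOn (Submodule.span ℂ (Set.range x))

/-- The vectors `(T - α)^{l-1-k} v`, `k = 0, …, l-1`, for an operator `T` in a subspace `S`. -/
def jordanString {S : Submodule ℂ K} (T : S →L[ℂ] S) (α : ℂ) (l : ℕ) (v : S) : Fin l → K :=
  fun k => ((((T - α • (1 : S →L[ℂ] S)) ^ (l - 1 - (k : ℕ))) v : S) : K)

/-- `T` is the operator in `S` induced by the relation `A`: its graph is `A ∩ (S × S)`. -/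
def IsInducedOperator (A : Submodule ℂ (K × K)) (S : Submodule ℂ K) (T : S →L[ℂ] S) : Prop :=
  ∀ u v : S, ((u : K), (v : K)) ∈ A ↔ T u = v

/-- The adjoint `Γ⁺ : S → H` of `Γ : H → S` for the scalar product `[., .]` restricted to `S`. -/
def KreinSymmetry.plusAdjointOn (P : KreinSymmetry K) {S : Submodule ℂ K} (Γ : H →L[ℂ] S) :
    S →L[ℂ] H :=
  P.plusAdjoint (S.subtypeL ∘L Γ) ∘L S.subtypeL

end Krein

/-! ### Generalized Nevanlinna functions -/

section Nevanlinna

variable {H : Type*} [NormedAddCommGroup H] [InnerProductSpace ℂ H] [CompleteSpace H]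

/-- The Nevanlinna kernel `N_Q(z, w) = (Q(z) - Q(w)*) / (z - conj w)`. -/
def nevanlinnaKernel (Q : ℂ → H →L[ℂ] H) (z w : ℂ) : H →L[ℂ] H :=
  (z - conj w)⁻¹ • (Q z - ContinuousLinearMap.adjoint (Q w))

/-- The matrix with entries `(N_Q(z_i, z_j) h_i, h_j)`. -/
def nevanlinnaMatrix (Q : ℂ → H →L[ℂ] H) {n : ℕ} (z : Fin n → ℂ) (h : Fin n → H) :
    Matrix (Fin n) (Fin n) ℂ :=
  fun i j => inner ℂ (h j) (nevanlinnaKernel Q (z i) (z j) (h i))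

theorem nevanlinnaMatrix_isHermitian (Q : ℂ → H →L[ℂ] H) {n : ℕ} (z : Fin n → ℂ)
    (h : Fin n → H) : (nevanlinnaMatrix Q z h).IsHermitian := by
  ext i j
  simp only [Matrix.conjTranspose_apply, nevanlinnaMatrix, nevanlinnaKernel,
    smul_apply, sub_apply, inner_smul_right,
    inner_sub_right, ContinuousLinearMap.adjoint_inner_right, RCLike.star_def, map_mul, map_sub,
    map_inv₀, Complex.conj_conj, inner_conj_symm]
  rw [← neg_sub (z i), inv_neg]
  ring

/-- The number of negative eigenvalues, with multiplicities, of the matrix above. -/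
def numNegEigenvalues (Q : ℂ → H →L[ℂ] H) {n : ℕ} (z : Fin n → ℂ) (h : Fin n → H) : ℕ :=
  (Finset.univ.filter fun i => (nevanlinnaMatrix_isHermitian Q z h).eigenvalues i < 0).card

/-- `Q ∈ N_κ(H)`, where `D` is the domain of `Q` (values of `Q` outside `D` play no role): `Q` is
holomorphic on the open set `D`, which contains all non-real points except isolated ones, where
`Q` is meromorphic; `Q(conj z)* = Q(z)` on `D`; and the Nevanlinna kernel has exactly `κ` negative
squares on the part of `D` in the open upper half-plane. -/
structure IsGenNevanlinna (D : Set ℂ) (Q : ℂ → H →L[ℂ] H) (κ : ℕ) : Prop where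
  isOpen_domain : IsOpen D
  analytic : AnalyticOnNhd ℂ Q D
  domain_nonreal : ∀ z : ℂ, z.im ≠ 0 → ∀ᶠ w in 𝓝[≠] z, w ∈ D
  meromorphic : MeromorphicOn Q {z : ℂ | z.im ≠ 0}
  domain_symm : ∀ z ∈ D, conj z ∈ D
  symm : ∀ z ∈ D, ContinuousLinearMap.adjoint (Q (conj z)) = Q z
  negSquares_le : ∀ (n : ℕ) (z : Fin n → ℂ) (h : Fin n → H),
    (∀ i, z i ∈ D ∧ 0 < (z i).im) → numNegEigenvalues Q z h ≤ κ
  negSquares_eq : ∃ (n : ℕ) (z : Fin n → ℂ) (h : Fin n → H),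
    (∀ i, z i ∈ D ∧ 0 < (z i).im) ∧ numNegEigenvalues Q z h = κ

/-- The set `σ(Q)` of finite singularities of `Q : D → L(H)`: the points of `ℂ` to which `Q` has
no holomorphic continuation. -/
def sigma (D : Set ℂ) (Q : ℂ → H →L[ℂ] H) : Set ℂ :=
  {w | ¬ ∃ g : ℂ → H →L[ℂ] H, AnalyticAt ℂ g w ∧ ∀ᶠ z in 𝓝[D] w, g z = Q z}

end Nevanlinna

end

end GenNevanlinna

namespace GenNevanlinna

noncomputable section

namespace KreinSymmetry

variable {K : Type*} [NormedAddCommGroup K] [InnerProductSpace ℂ K] [CompleteSpace K]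
  (P : KreinSymmetry K)

/-! ### The indefinite scalar product -/

/-! Write Γ_z for the γ-field. The representation and the resolvent identity give N_Q(z, w) = Γ_w⁺
Γ_z (`IsRepresentedBy.kernel_eq`), so the Nevanlinna kernel is a Gram kernel and its negative
squares measure how negative the span of the vectors Γ_z h, Im z > 0, is. Minimality speaks of all z
∈ ρ(A), not only of the upper half-plane. The gap is closed by Cayley transforms of A: they are
commuting isometries that preserve the closed upper span and push the vectors Γ_z h from the lower
half-plane into it. As negative definiteness of a finite Gram matrix is an open condition, κ is the
negative index of the whole space K (`exists_hasNegDim_span`, `negSquares_of_gram`).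

The span S of the chain is finite-dimensional and non-degenerate, so K splits orthogonally into S
and its companion. A induces an operator A₁ in S because A(0) is orthogonal to dom A. The resolvents
leave S invariant, hence commute with the projection E, and the factor A₁ - z₀ in Γ₁ is exactly what
yields (A₁ - z)⁻¹ Γ₁ = E Γ_z. Thus the kernels of Q₁ and of Q₂ = Q - Q₁ are the Gram kernels of E
Γ_z and (1 - E) Γ_z. The density argument, applied to each projection, identifies κ₁ and κ₂ with the
negative indices of the two summands, and these add up (`KreinSymmetry.maximal_hasNegDim_add`,
`exists_decomposition`).

On S put N = A₁ - α; then N^l = 0 and N^(l-1) S = ℂ x₀. If N^(l-1) Γ₁ vanished, N^(l-1) E would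
annihilate every Γ_z h, against minimality (`exists_pow_pred_apply_ne_zero`). So some Γ₁ h satisfies
N^(l-1) Γ₁ h = x₀. Such a vector is cyclic for N and generates the required chain; non-degeneracy
gives [x₀, Γ₁ h] ≠ 0, so Q₁ has a genuine pole of order l at α (`sigma_poleFunction`). -/

@[simp] theorem form_add_left (x y z : K) : P.form (x + y) z = P.form x z + P.form y z := by
  simp [form]

@[simp] theorem form_add_right (x y z : K) : P.form x (y + z) = P.form x y + P.form x z := by
  simp [form]

@[simp] theorem form_sub_left (x y z : K) : P.form (x - y) z = P.form x z - P.form y z := by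
  simp [form]

@[simp] theorem form_sub_right (x y z : K) : P.form x (y - z) = P.form x y - P.form x z := by
  simp [form]

@[simp] theorem form_smul_left (c : ℂ) (x y : K) : P.form (c • x) y = c * P.form x y := by
  simp [form]

@[simp] theorem form_smul_right (c : ℂ) (x y : K) : P.form x (c • y) = conj c * P.form x y := by
  simp [form, mul_comm]

@[simp] theorem form_zero_left (x : K) : P.form 0 x = 0 := by simp [form]

@[simp] theorem form_zero_right (x : K) : P.form x 0 = 0 := by simp [form]

theorem form_sum_left {ι : Type*} (s : Finset ι) (f : ι → K) (y : K) :
    P.form (∑ i ∈ s, f i) y = ∑ i ∈ s, P.form (f i) y := by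
  simp [form]

theorem form_sum_right {ι : Type*} (s : Finset ι) (f : ι → K) (y : K) :
    P.form y (∑ i ∈ s, f i) = ∑ i ∈ s, P.form y (f i) := by
  simp [form]

theorem inner_J (x y : K) : inner ℂ (P.J x) y = inner ℂ x (P.J y) :=
  (ContinuousLinearMap.isSelfAdjoint_iff_isSymmetric.mp P.isSelfAdjoint) x y

theorem conj_form (x y : K) : conj (P.form x y) = P.form y x := by
  rw [form, form, inner_conj_symm, inner_J]

@[simp] theorem J_J (x : K) : P.J (P.J x) = x :=
  congrArg (fun T : K →L[ℂ] K => T x) P.sq_eq_id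

/-! ### Families of vectors with a negative definite Gram matrix -/

/-- The Gram matrix of the family `f` with respect to `[., .]` is negative definite. -/
def IsNegFamily {ι : Type*} [Fintype ι] (f : ι → K) : Prop :=
  ∀ c : ι → ℂ, c ≠ 0 → (P.form (∑ i, c i • f i) (∑ i, c i • f i)).re < 0

/-- The set `W` contains `n` vectors with a negative definite Gram matrix. -/
def HasNegDim (W : Set K) (n : ℕ) : Prop :=
  ∃ f : Fin n → K, (∀ i, f i ∈ W) ∧ P.IsNegFamily f

variable {P}

theorem IsNegFamily.comp_equiv {ι κ : Type*} [Fintype ι] [Fintype κ] {f : ι → K}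
    (hf : P.IsNegFamily f) (e : κ ≃ ι) : P.IsNegFamily (f ∘ e) := by
  intro c hc
  have := hf (c ∘ e.symm) (fun h => hc (by
    funext i
    simpa using congrFun h (e i)))
  have hs : ∑ i, (c ∘ e.symm) i • f i = ∑ i, c i • (f ∘ e) i := by
    rw [← e.sum_comp]
    simp
  rwa [hs] at this

theorem IsNegFamily.map {ι : Type*} [Fintype ι] {f : ι → K} (hf : P.IsNegFamily f)
    {V : K →L[ℂ] K} (hV : ∀ x y, P.form (V x) (V y) = P.form x y) :
    P.IsNegFamily fun i => V (f i) := by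
  intro c hc
  have hs : ∑ i, c i • V (f i) = V (∑ i, c i • f i) := by simp
  rw [hs, hV]
  exact hf c hc

theorem isNegFamily_single {y : K} (hy : (P.form y y).re < 0) :
    P.IsNegFamily (fun _ : Fin 1 => y) := by
  intro c hc
  have h0 : c 0 ≠ 0 := fun h => hc (by
    funext i
    rw [Subsingleton.elim i 0, h]
    rfl)
  have : P.form (∑ i, c i • y) (∑ i, c i • y) = ((Complex.normSq (c 0) : ℝ) : ℂ) * P.form y y := by
    simp only [Finset.univ_unique, Fin.default_eq_zero, Finset.sum_singleton, form_smul_left,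
      form_smul_right, ← Complex.mul_conj]
    ring
  rw [this, Complex.re_ofReal_mul]
  exact mul_neg_of_pos_of_neg (Complex.normSq_pos.mpr h0) hy

theorem IsNegFamily.append {m n : ℕ} {f : Fin m → K} {g : Fin n → K} (hf : P.IsNegFamily f)
    (hg : P.IsNegFamily g) (hfg : ∀ i j, P.form (f i) (g j) = 0) :
    P.IsNegFamily (Fin.append f g) := by
  intro c hc
  set a := ∑ i, c (Fin.castAdd n i) • f i with ha
  set b := ∑ j, c (Fin.natAdd m j) • g j with hb
  have hs : ∑ i, c i • Fin.append f g i = a + b := by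
    rw [Fin.sum_univ_add]
    simp [ha, hb]
  have hab : P.form a b = 0 := by
    simp [ha, hb, form_sum_left, form_sum_right, hfg]
  have hba : P.form b a = 0 := by rw [← conj_form, hab, map_zero]
  have hsum : P.form (a + b) (a + b) = P.form a a + P.form b b := by
    simp [hab, hba]
  rw [hs, hsum, Complex.add_re]
  by_cases h1 : (fun i => c (Fin.castAdd n i)) = 0
  · have h2 : (fun j => c (Fin.natAdd m j)) ≠ 0 := by
      intro h2
      apply hc
      funext i
      refine Fin.addCases (fun i => ?_) (fun j => ?_) i
      · exact congrFun h1 i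
      · exact congrFun h2 j
    have ha0 : a = 0 := by
      rw [ha]
      exact Finset.sum_eq_zero fun i _ => by
        have := congrFun h1 i
        simp only [Pi.zero_apply] at this
        rw [this, zero_smul]
    have := hg _ h2
    rw [ha0]
    simpa using this
  · have h3 := hf _ h1
    by_cases h2 : (fun j => c (Fin.natAdd m j)) = 0
    · have hb0 : b = 0 := by
        rw [hb]
        exact Finset.sum_eq_zero fun i _ => by
          have := congrFun h2 i
          simp only [Pi.zero_apply] at this
          rw [this, zero_smul]
      rw [hb0]
      simpa using h3
    · exact add_neg h3 (hg _ h2)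

theorem HasNegDim.mono {W W' : Set K} (h : W ⊆ W') {n : ℕ} (hn : P.HasNegDim W n) :
    P.HasNegDim W' n := by
  obtain ⟨f, hf, hf'⟩ := hn
  exact ⟨f, fun i => h (hf i), hf'⟩

/-- The map I - J sends K into K₋ and is injective on the span of a negative family: Jy = y would
make [y, y] = ‖y‖² ≥ 0. -/
theorem HasNegDim.le_finrank (hP : P.IsPontryagin) {W : Set K} {n : ℕ} (hn : P.HasNegDim W n) :
    n ≤ Module.finrank ℂ P.negPart := by
  obtain ⟨f, -, hf⟩ := hn
  have : FiniteDimensional ℂ P.negPart := hP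
  let T : (Fin n → ℂ) →ₗ[ℂ] K :=
    (ContinuousLinearMap.id ℂ K - P.J).toLinearMap ∘ₗ Fintype.linearCombination ℂ f
  have hT : ∀ c, T c = (∑ i, c i • f i) - P.J (∑ i, c i • f i) := fun c => by
    simp [T, Fintype.linearCombination_apply, smul_sub]
  let T' : (Fin n → ℂ) →ₗ[ℂ] P.negPart := T.codRestrict _ fun c => by
    rw [hT]
    simp only [negPart, LinearMap.mem_ker, ContinuousLinearMap.coe_coe,
      add_apply, ContinuousLinearMap.id_apply, map_sub, J_J]
    abel
  have hinj : Function.Injective T' := by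
    rw [← LinearMap.ker_eq_bot, LinearMap.ker_eq_bot']
    intro c hc
    by_contra h0
    have h1 := hf c h0
    have h2 : T c = 0 := congrArg Subtype.val hc
    rw [hT, sub_eq_zero] at h2
    rw [form, ← h2] at h1
    have h3 : 0 ≤ (inner ℂ (∑ i, c i • f i) (∑ i, c i • f i)).re := inner_self_nonneg (𝕜 := ℂ)
    exact absurd h1 (not_lt.mpr h3)
  simpa using LinearMap.finrank_le_finrank_of_injective hinj

theorem exists_maximal_hasNegDim (hP : P.IsPontryagin) (W : Set K) :
    ∃ n, P.HasNegDim W n ∧ ∀ m, P.HasNegDim W m → m ≤ n := by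
  have hne : {n | P.HasNegDim W n}.Nonempty :=
    ⟨0, Fin.elim0, fun i => i.elim0, fun c hc => (hc (Subsingleton.elim _ _)).elim⟩
  have hbdd : BddAbove {n | P.HasNegDim W n} :=
    ⟨_, fun n hn => HasNegDim.le_finrank hP hn⟩
  exact ⟨_, Nat.sSup_mem hne hbdd, fun m hm => le_csSup hbdd hm⟩

/-- A negative family spans a space that contains a non-zero vector orthogonal to fewer given
vectors. -/
theorem IsNegFamily.exists_orthogonal {n : ℕ} {f : Fin n → K} (hf : P.IsNegFamily f) {ι : Type*}
    [Fintype ι] (g : ι → K) (hcard : Fintype.card ι < n) :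
    ∃ y ∈ Submodule.span ℂ (Set.range f), (P.form y y).re < 0 ∧ ∀ i, P.form y (g i) = 0 := by
  let T : (Fin n → ℂ) →ₗ[ℂ] (ι → ℂ) :=
    { toFun := fun c i => P.form (∑ k, c k • f k) (g i)
      map_add' := fun c d => by
        funext i
        simp [add_smul, Finset.sum_add_distrib]
      map_smul' := fun a c => by
        funext i
        simp [form_sum_left, Finset.mul_sum, mul_assoc] }
  have hker : LinearMap.ker T ≠ ⊥ := LinearMap.ker_ne_bot_of_finrank_lt (by simpa using hcard)
  obtain ⟨c, hc, hc0⟩ := Submodule.exists_mem_ne_zero_of_ne_bot hker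
  refine ⟨∑ k, c k • f k, ?_, hf c hc0, fun i => congrFun (LinearMap.mem_ker.mp hc) i⟩
  exact Submodule.sum_mem _ fun k _ =>
    Submodule.smul_mem _ _ (Submodule.subset_span ⟨k, rfl⟩)

/-- Otherwise y could be appended to the family, contradicting its maximal length. -/
theorem form_self_nonneg_of_maximal {W : Submodule ℂ K} {n : ℕ} {f : Fin n → K}
    (hfW : ∀ i, f i ∈ W) (hf : P.IsNegFamily f)
    (hmax : ∀ m, P.HasNegDim (W : Set K) m → m ≤ n) {y : K} (hy : y ∈ W)
    (hyf : ∀ i, P.form y (f i) = 0) : 0 ≤ (P.form y y).re := by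
  by_contra! h
  have h1 : P.HasNegDim (W : Set K) (n + 1) := by
    refine ⟨Fin.append f fun _ => y, fun i => ?_, hf.append (isNegFamily_single h) fun i j => ?_⟩
    · refine Fin.addCases (fun i => ?_) (fun j => ?_) i
      · simpa using hfW i
      · simpa using hy
    · rw [← conj_form, hyf, map_zero]
  have := hmax _ h1
  omega

/-- The maximal number of negative squares is additive along an orthogonal projection. -/
theorem maximal_hasNegDim_add {E : K →L[ℂ] K} (hE : E ∘L E = E)
    (hsymm : ∀ x y, P.form (E x) y = P.form x (E y)) {n₁ n₂ n : ℕ}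
    (h₁ : P.HasNegDim (LinearMap.range E.toLinearMap : Set K) n₁)
    (hmax₁ : ∀ m, P.HasNegDim (LinearMap.range E.toLinearMap : Set K) m → m ≤ n₁)
    (h₂ : P.HasNegDim (LinearMap.range (1 - E).toLinearMap : Set K) n₂)
    (hmax₂ : ∀ m, P.HasNegDim (LinearMap.range (1 - E).toLinearMap : Set K) m → m ≤ n₂)
    (h : P.HasNegDim Set.univ n) (hmax : ∀ m, P.HasNegDim Set.univ m → m ≤ n) :
    n₁ + n₂ = n := by
  obtain ⟨f₁, hf₁, hn₁⟩ := h₁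
  obtain ⟨f₂, hf₂, hn₂⟩ := h₂
  obtain ⟨f, -, hn⟩ := h
  have hEE : ∀ x, E (E x) = E x := fun x => congrArg (fun T : K →L[ℂ] K => T x) hE
  have hE₁ : ∀ i, E (f₁ i) = f₁ i := fun i => by
    obtain ⟨x, hx⟩ := hf₁ i
    rw [← hx]
    exact hEE x
  have hE₂ : ∀ i, E (f₂ i) = 0 := fun i => by
    obtain ⟨x, hx⟩ := hf₂ i
    rw [← hx]
    simp [hEE]
  apply le_antisymm
  · exact hmax _ ⟨Fin.append f₁ f₂, fun _ => trivial, hn₁.append hn₂ fun i j => by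
      rw [← hE₁, hsymm, hE₂, form_zero_right]⟩
  · by_contra! hlt
    -- If n exceeded n₁ + n₂, some y with [y, y] < 0 would be orthogonal to both maximal families.
    -- Its two components are then non-negative by maximality, and [y, y] is the sum of their
    -- squares.
    obtain ⟨y, -, hy, hyo⟩ := hn.exists_orthogonal (Sum.elim f₁ f₂) (by simpa using hlt)
    have ho₁ : ∀ i, P.form (E y) (f₁ i) = 0 := fun i => by
      rw [hsymm, hE₁]
      exact hyo (Sum.inl i)
    have ho₂ : ∀ i, P.form (y - E y) (f₂ i) = 0 := fun i => by
      rw [form_sub_left, hsymm, hE₂, form_zero_right, sub_zero]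
      exact hyo (Sum.inr i)
    have p₁ : 0 ≤ (P.form (E y) (E y)).re := form_self_nonneg_of_maximal hf₁ hn₁ hmax₁ ⟨y, rfl⟩ ho₁
    have p₂ := form_self_nonneg_of_maximal hf₂ hn₂ hmax₂
      (show y - E y ∈ _ from ⟨y, by simp⟩) ho₂
    have hsum : P.form y y = P.form (E y) (E y) + P.form (y - E y) (y - E y) := by
      have e1 : P.form (E y) (E y) = P.form y (E y) := by rw [hsymm, hEE]
      have e2 : P.form (E y) y = P.form y (E y) := hsymm y y
      simp only [form_sub_left, form_sub_right, e1, e2]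
      ring
    rw [hsum, Complex.add_re] at hy
    linarith

/-! ### Stability under small perturbations -/

/-- By homogeneity only coefficient vectors on the unit sphere matter; that sphere is compact, so
strict negativity survives small perturbations of the family. -/
theorem isOpen_isNegFamily (P : KreinSymmetry K) (n : ℕ) :
    IsOpen {f : Fin n → K | P.IsNegFamily f} := by
  have hset : {f : Fin n → K | P.IsNegFamily f} = {f : Fin n → K |
      ∀ c ∈ Metric.sphere (0 : Fin n → ℂ) 1,
        (P.form (∑ i, c i • f i) (∑ i, c i • f i)).re < 0} := by
    ext f
    constructor
    · intro hf c hc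
      refine hf c fun h => ?_
      simp [h] at hc
    · intro hf c hc
      have hc' : ‖c‖ ≠ 0 := norm_ne_zero_iff.mpr hc
      have h1 := hf (((‖c‖⁻¹ : ℝ) : ℂ) • c) (by
        simp [norm_smul, hc'])
      have h2 : ∑ i, ((((‖c‖⁻¹ : ℝ) : ℂ) • c) i) • f i
          = ((‖c‖⁻¹ : ℝ) : ℂ) • ∑ i, c i • f i := by
        simp [Finset.smul_sum, smul_smul]
      rw [h2, form_smul_left, form_smul_right, Complex.conj_ofReal, Complex.re_ofReal_mul,
        Complex.re_ofReal_mul, ← mul_assoc] at h1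
      have h3 : 0 < ‖c‖⁻¹ * ‖c‖⁻¹ := by positivity
      exact neg_of_mul_neg_right h1 h3.le
  rw [hset, isOpen_iff_mem_nhds]
  intro f hf
  have hcont : Continuous fun p : (Fin n → K) × (Fin n → ℂ) =>
      (P.form (∑ i, p.2 i • p.1 i) (∑ i, p.2 i • p.1 i)).re := by
    unfold form
    fun_prop
  refine (isCompact_sphere (0 : Fin n → ℂ) 1).eventually_forall_of_forall_eventually ?_
  intro c hc
  exact hcont.continuousAt.eventually_lt continuousAt_const (hf c hc)

theorem HasNegDim.of_closure {L : Set K} {n : ℕ} (h : P.HasNegDim (closure L) n) :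
    P.HasNegDim L n := by
  obtain ⟨f, hf, hn⟩ := h
  have hcl : f ∈ closure (Set.pi Set.univ fun _ : Fin n => L) := by
    rw [closure_pi_set]
    exact fun i _ => hf i
  obtain ⟨g, hg, hgL⟩ := mem_closure_iff.mp hcl _ (isOpen_isNegFamily P n) hn
  exact ⟨g, fun i => hgL i trivial, hg⟩

/-! ### Gram matrices -/

theorem exists_diagonal_gram (P : KreinSymmetry K) {n : ℕ} (u : Fin n → K)
    {M : Matrix (Fin n) (Fin n) ℂ}
    (hM : M.IsHermitian) (hMu : ∀ i j, M i j = P.form (u i) (u j)) :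
    ∃ w : Fin n → K,
      (∀ a b, P.form (w a) (w b) = if a = b then (hM.eigenvalues a : ℂ) else 0) ∧
      (∀ a, w a ∈ Submodule.span ℂ (Set.range u)) ∧
      (∀ i, u i ∈ Submodule.span ℂ (Set.range w)) := by
  set V : Matrix (Fin n) (Fin n) ℂ := (hM.eigenvectorUnitary : Matrix (Fin n) (Fin n) ℂ) with hV
  have hVV : V * V.conjTranspose = 1 := by
    have := Unitary.coe_mul_star_self hM.eigenvectorUnitary
    simpa [Matrix.star_eq_conjTranspose] using this
  have hVV' : V.conjTranspose * V = 1 := by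
    have := Unitary.coe_star_mul_self hM.eigenvectorUnitary
    simpa [Matrix.star_eq_conjTranspose] using this
  have hspec : V.conjTranspose * M * V = Matrix.diagonal (fun a => (hM.eigenvalues a : ℂ)) := by
    have h1 : M * V = V * Matrix.diagonal (fun a => (hM.eigenvalues a : ℂ)) := by
      ext i a
      have h2 := congrFun (hM.mulVec_eigenvectorBasis a) i
      rw [Matrix.mul_diagonal]
      simp only [Matrix.mulVec, dotProduct, Pi.smul_apply] at h2
      rw [Matrix.mul_apply]
      simpa [hV, Matrix.IsHermitian.eigenvectorUnitary_apply, mul_comm] using h2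
    rw [Matrix.mul_assoc, h1, ← Matrix.mul_assoc, hVV', Matrix.one_mul]
  -- The conjugate is dictated by the form being linear in its first argument: it makes the Gram
  -- matrix of the new vectors equal to Vᴴ M V, which is diagonal.
  refine ⟨fun a => ∑ i, conj (V i a) • u i, fun a b => ?_, fun a => ?_, fun i => ?_⟩
  · have h1 := congrFun (congrFun hspec a) b
    rw [Matrix.diagonal_apply] at h1
    rw [← h1, Matrix.mul_apply]
    simp only [form_sum_left, form_sum_right, form_smul_left, form_smul_right, Complex.conj_conj,
      Matrix.mul_apply, Matrix.conjTranspose_apply, hMu, Finset.mul_sum, Finset.sum_mul]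
    refine Finset.sum_congr rfl fun i _ => Finset.sum_congr rfl fun j _ => ?_
    simp only [RCLike.star_def]
    ring
  · exact Submodule.sum_mem _ fun k _ =>
      Submodule.smul_mem _ _ (Submodule.subset_span ⟨k, rfl⟩)
  · have : u i = ∑ a, V i a • ∑ j, conj (V j a) • u j := by
      simp only [Finset.smul_sum, smul_smul]
      rw [Finset.sum_comm]
      have h2 : ∀ j, ∑ a, (V i a * conj (V j a)) • u j = (1 : Matrix (Fin n) (Fin n) ℂ) i j • u j :=
        fun j => by
          rw [← Finset.sum_smul, ← hVV, Matrix.mul_apply]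
          simp [Matrix.conjTranspose_apply]
      simp [h2, Matrix.one_apply]
    rw [this]
    exact Submodule.sum_mem _ fun k _ =>
      Submodule.smul_mem _ _ (Submodule.subset_span ⟨k, rfl⟩)

theorem form_self_eq_sum_of_diagonal {n : ℕ} {w : Fin n → K} {lam : Fin n → ℝ}
    (hw : ∀ a b, P.form (w a) (w b) = if a = b then (lam a : ℂ) else 0) {s : Finset (Fin n)}
    (c : Fin n → ℂ) :
    (P.form (∑ a ∈ s, c a • w a) (∑ a ∈ s, c a • w a)).re
      = ∑ a ∈ s, Complex.normSq (c a) * lam a := by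
  have : P.form (∑ a ∈ s, c a • w a) (∑ a ∈ s, c a • w a)
      = ((∑ a ∈ s, Complex.normSq (c a) * lam a : ℝ) : ℂ) := by
    simp only [form_sum_left, form_sum_right, form_smul_left, form_smul_right, hw]
    push_cast
    refine Finset.sum_congr rfl fun a ha => ?_
    rw [← Complex.mul_conj]
    simp [ha]
    ring
  rw [this, Complex.ofReal_re]

theorem hasNegDim_of_gram (P : KreinSymmetry K) {n : ℕ} (u : Fin n → K)
    {M : Matrix (Fin n) (Fin n) ℂ}
    (hM : M.IsHermitian) (hMu : ∀ i j, M i j = P.form (u i) (u j)) :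
    P.HasNegDim (Submodule.span ℂ (Set.range u) : Set K)
      (Finset.univ.filter fun i => hM.eigenvalues i < 0).card := by
  obtain ⟨w, hw, hwu, -⟩ := P.exists_diagonal_gram u hM hMu
  set s := Finset.univ.filter fun i => hM.eigenvalues i < 0 with hs
  have hneg : P.IsNegFamily fun a : s => w a := by
    intro c hc
    let d : Fin n → ℂ := fun a => if h : a ∈ s then c ⟨a, h⟩ else 0
    have hsum : ∑ a : s, c a • w a = ∑ a ∈ s, d a • w a := by
      rw [← Finset.sum_coe_sort s]
      exact Finset.sum_congr rfl fun a _ => by simp [d]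
    rw [hsum, form_self_eq_sum_of_diagonal hw]
    obtain ⟨a, ha⟩ := Function.ne_iff.mp hc
    refine Finset.sum_neg' (fun b hb => ?_) ⟨a, a.2, ?_⟩
    · exact mul_nonpos_of_nonneg_of_nonpos (Complex.normSq_nonneg _)
        (Finset.mem_filter.mp hb).2.le
    · refine mul_neg_of_pos_of_neg (Complex.normSq_pos.mpr ?_) (Finset.mem_filter.mp a.2).2
      simpa [d] using ha
  exact ⟨_, fun i => hwu _, hneg.comp_equiv s.equivFin.symm⟩

/-- The law of inertia: a longer negative family would span a negative vector orthogonal to all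
diagonalizing vectors with negative eigenvalue. Its coefficients there vanish, so its square is a
non-negative sum. -/
theorem HasNegDim.le_card_of_gram {n : ℕ} {u : Fin n → K} {M : Matrix (Fin n) (Fin n) ℂ}
    (hM : M.IsHermitian) (hMu : ∀ i j, M i j = P.form (u i) (u j)) {m : ℕ}
    (hm : P.HasNegDim (Submodule.span ℂ (Set.range u) : Set K) m) :
    m ≤ (Finset.univ.filter fun i => hM.eigenvalues i < 0).card := by
  obtain ⟨w, hw, -, huw⟩ := P.exists_diagonal_gram u hM hMu
  obtain ⟨f, hf, hn⟩ := hm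
  by_contra! hlt
  set s := Finset.univ.filter fun i => hM.eigenvalues i < 0 with hs
  obtain ⟨y, hy, hneg, hyo⟩ := hn.exists_orthogonal (fun a : s => w a) (by simpa using hlt)
  have hyw : y ∈ Submodule.span ℂ (Set.range w) := by
    refine Submodule.span_le.mpr ?_ hy
    rintro _ ⟨i, rfl⟩
    refine Submodule.span_le.mpr ?_ (hf i)
    rintro _ ⟨j, rfl⟩
    exact huw j
  obtain ⟨c, rfl⟩ := (Submodule.mem_span_range_iff_exists_fun ℂ).mp hyw
  rw [form_self_eq_sum_of_diagonal hw] at hneg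
  refine absurd hneg (not_lt.mpr (Finset.sum_nonneg fun a _ => ?_))
  by_cases ha : hM.eigenvalues a < 0
  · have h1 := hyo ⟨a, by simp [hs, ha]⟩
    simp only [form_sum_left, form_smul_left, hw] at h1
    have h2 : c a = 0 := by
      have h3 : c a * (hM.eigenvalues a : ℂ) = 0 := by simpa using h1
      exact (mul_eq_zero.mp h3).resolve_right (by exact_mod_cast ha.ne)
    simp [h2]
  · exact mul_nonneg (Complex.normSq_nonneg _) (not_lt.mp ha)

end KreinSymmetry

end

end GenNevanlinna

namespace GenNevanlinna

noncomputable section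

set_option linter.unusedSectionVars false

variable {H K : Type*} [NormedAddCommGroup H] [InnerProductSpace ℂ H]
  [NormedAddCommGroup K] [InnerProductSpace ℂ K] [CompleteSpace K]

/-! ### Resolvents of linear relations -/

section Resolvent

variable {A : Submodule ℂ (K × K)} {z w : ℂ}

theorem IsResolventAt.eq_relResolvent {R : K →L[ℂ] K} (hR : IsResolventAt A z R) :
    relResolvent A z = R := by
  ext f
  exact (relResolvent_spec ⟨R, hR⟩ f _).mp ((hR f _).mpr rfl)

theorem relResolvent_mem (hz : z ∈ relResolventSet A) (f : K) :
    (relResolvent A z f, f + z • relResolvent A z f) ∈ A :=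
  (relResolvent_spec hz f _).mpr rfl

theorem relResolvent_eq (hz : z ∈ relResolventSet A) {f x : K} (h : (x, f + z • x) ∈ A) :
    relResolvent A z f = x :=
  (relResolvent_spec hz f x).mp h

theorem notMem_relResolventSet {x : K} (hx : x ≠ 0) (h : (x, z • x) ∈ A) :
    z ∉ relResolventSet A := fun hz => hx <| by
  have := relResolvent_eq hz (f := 0) (x := x) (by simpa using h)
  rwa [map_zero, eq_comm] at this

/-- The resolvent identity. -/
theorem relResolvent_sub (hz : z ∈ relResolventSet A) (hw : w ∈ relResolventSet A) (f : K) :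
    (z - w) • relResolvent A w (relResolvent A z f) = relResolvent A z f - relResolvent A w f := by
  have h := relResolvent_mem hz f
  -- The same pair of A is read once as a resolvent equation at z and once, with a shifted
  -- right-hand side, at w.
  have h2 := relResolvent_eq hw (f := f + (z - w) • relResolvent A z f)
    (x := relResolvent A z f) (by
      convert h using 2
      module)
  rw [map_add, map_smul] at h2
  rw [← eq_sub_iff_add_eq'.mpr h2]

theorem relResolvent_comm (hz : z ∈ relResolventSet A) (hw : w ∈ relResolventSet A) (f : K) :
    relResolvent A w (relResolvent A z f) = relResolvent A z (relResolvent A w f) := by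
  rcases eq_or_ne z w with rfl | hzw
  · rfl
  have h1 := relResolvent_sub hz hw f
  have h2 := relResolvent_sub hw hz f
  refine smul_right_injective K (sub_ne_zero.mpr hzw) ?_
  change (z - w) • _ = (z - w) • _
  rw [h1, ← neg_sub w z, neg_smul, h2, neg_sub]

/-- Near z the operator 1 - (w - z) R(z) is invertible, and its inverse times R(z) is the resolvent
at w. -/
theorem continuousAt_relResolvent (hz : z ∈ relResolventSet A) :
    ContinuousAt (relResolvent A) z := by
  set R := relResolvent A z with hR
  let B : ℂ → K →L[ℂ] K := fun w => 1 - (w - z) • R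
  have hB : Continuous B := by fun_prop
  have hBz : B z = 1 := by simp [B]
  have hunit : ∀ᶠ w in 𝓝 z, IsUnit (B w) := by
    refine hB.continuousAt.eventually ?_
    rw [hBz]
    exact Units.isOpen.mem_nhds isUnit_one
  have heq : ∀ᶠ w in 𝓝 z, Ring.inverse (B w) * R = relResolvent A w := by
    filter_upwards [hunit] with w hw
    symm
    apply IsResolventAt.eq_relResolvent
    intro f x
    have e : f + w • x = (f + (w - z) • x) + z • x := by module
    rw [e, relResolvent_spec hz, ← hR, map_add, map_smul]
    have e2 : R f + (w - z) • R x = x ↔ R f = B w x := by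
      simp only [B, sub_apply, smul_apply, one_apply_eq_self]
      rw [eq_sub_iff_add_eq]
    rw [e2]
    constructor
    · intro h
      rw [mul_apply_eq_comp, h, ← mul_apply_eq_comp,
        Ring.inverse_mul_cancel _ hw]
      rfl
    · intro h
      rw [← h, ← mul_apply_eq_comp, ← mul_assoc, Ring.mul_inverse_cancel _ hw, one_mul]
  refine ContinuousAt.congr ?_ heq
  have h1 : ContinuousAt (fun w => Ring.inverse (B w)) z := by
    refine ContinuousAt.comp (g := Ring.inverse) ?_ hB.continuousAt
    rw [hBz]
    exact NormedRing.inverse_continuousAt (1 : (K →L[ℂ] K)ˣ)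
  exact h1.mul continuousAt_const

theorem KreinSymmetry.form_relResolvent {P : KreinSymmetry K} (hA : P.IsSelfAdjointRel A)
    (hz : z ∈ relResolventSet A) (hz' : conj z ∈ relResolventSet A) (f g : K) :
    P.form (relResolvent A z f) g = P.form f (relResolvent A (conj z) g) := by
  have h := (hA _).mp (relResolvent_mem hz' g) _ (relResolvent_mem hz f)
  simp only [form_add_left, form_add_right, form_smul_left, form_smul_right,
    Complex.conj_conj] at h
  exact (add_right_cancel h).symm

theorem gammaField_apply (A : Submodule ℂ (K × K)) (z₀ : ℂ) (Γ : H →L[ℂ] K) (z : ℂ) (h : H) :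
    gammaField A z₀ Γ z h = Γ h + (z - z₀) • relResolvent A z (Γ h) := rfl

/-- This keeps the span of the γ-field invariant under resolvents, and lets Cayley transforms carry
Γ_z to the conjugate point. -/
theorem relResolvent_gammaField (z₀ : ℂ) (Γ : H →L[ℂ] K) (hz : z ∈ relResolventSet A)
    (hw : w ∈ relResolventSet A) (h : H) :
    (z - w) • relResolvent A w (gammaField A z₀ Γ z h)
      = gammaField A z₀ Γ z h - gammaField A z₀ Γ w h := by
  have h1 := relResolvent_sub hz hw (Γ h)
  simp only [gammaField_apply, map_add, map_smul, smul_add]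
  rw [smul_comm, h1]
  module

theorem continuousAt_gammaField (z₀ : ℂ) (Γ : H →L[ℂ] K) (hz : z ∈ relResolventSet A) (h : H) :
    ContinuousAt (fun w => gammaField A z₀ Γ w h) z := by
  simp only [gammaField_apply]
  have h1 : ContinuousAt (fun w => relResolvent A w (Γ h)) z :=
    (continuousAt_relResolvent hz).clm_apply continuousAt_const
  fun_prop

/-- The Cayley transform `(A - conj w)(A - w)⁻¹`. -/
def cayley (A : Submodule ℂ (K × K)) (w : ℂ) : K →L[ℂ] K :=
  1 + (w - conj w) • relResolvent A w

theorem cayley_apply (x : K) : cayley A w x = x + (w - conj w) • relResolvent A w x := rfl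

theorem KreinSymmetry.form_cayley {P : KreinSymmetry K} (hA : P.IsSelfAdjointRel A)
    (hz : z ∈ relResolventSet A) (hz' : conj z ∈ relResolventSet A) (x y : K) :
    P.form (cayley A z x) (cayley A z y) = P.form x y := by
  have h1 := congrArg (fun v => P.form v y) (relResolvent_sub hz hz' x)
  have h2 := form_relResolvent hA hz' (by simpa using hz) (relResolvent A z x) y
  have h3 := form_relResolvent hA hz' (by simpa using hz) x y
  simp only [Complex.conj_conj, form_smul_left, form_sub_left] at h1 h2 h3
  simp only [cayley_apply, form_add_left, form_add_right, form_smul_left, form_smul_right, map_sub,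
    Complex.conj_conj]
  rw [← h2, ← h3]
  linear_combination (-(z - conj z)) * h1

end Resolvent

/-! ### Density of the values of the γ-field in the upper half-plane -/

section Density

/-- The closed linear span of the vectors `F Γ_z h` with `z ∈ D` in the upper half-plane. -/
def upperSpan (D : Set ℂ) (A : Submodule ℂ (K × K)) (Γ : H →L[ℂ] K) (z₀ : ℂ) (F : K →L[ℂ] K) :
    Submodule ℂ K :=
  (Submodule.span ℂ {y : K | ∃ z ∈ D, 0 < z.im ∧
    ∃ h : H, y = F (gammaField A z₀ Γ z h)}).topologicalClosure

/-- Isometries in the bicommutant of the resolvents that leave `upperSpan` invariant. -/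
structure IsUpperShift (P : KreinSymmetry K) (D : Set ℂ) (A : Submodule ℂ (K × K))
    (Γ : H →L[ℂ] K) (z₀ : ℂ) (F V : K →L[ℂ] K) : Prop where
  isometric : ∀ x y, P.form (V x) (V y) = P.form x y
  map_mem : ∀ y ∈ upperSpan D A Γ z₀ F, V y ∈ upperSpan D A Γ z₀ F
  commute : ∀ T : K →L[ℂ] K, (∀ w ∈ D, ∀ x, T (relResolvent A w x) = relResolvent A w (T x)) →
    ∀ x, T (V x) = V (T x)

variable {P : KreinSymmetry K} {D : Set ℂ} {A : Submodule ℂ (K × K)} {Γ : H →L[ℂ] K} {z₀ : ℂ}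
  {F : K →L[ℂ] K}

theorem mem_upperSpan {z : ℂ} (hz : z ∈ D) (him : 0 < z.im) (h : H) :
    F (gammaField A z₀ Γ z h) ∈ upperSpan D A Γ z₀ F :=
  Submodule.le_topologicalClosure _ (Submodule.subset_span ⟨z, hz, him, h, rfl⟩)

theorem isClosed_upperSpan : IsClosed (upperSpan D A Γ z₀ F : Set K) :=
  Submodule.isClosed_topologicalClosure _

/-- For z ≠ w the image of F Γ_z h is a multiple of a difference of two γ-field values. The case z =
w is a limit of these, and the rest is linearity and closure. -/
theorem relResolvent_mem_upperSpan (hDo : IsOpen D) (hD : D ⊆ relResolventSet A)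
    (hF : ∀ w ∈ D, ∀ x, F (relResolvent A w x) = relResolvent A w (F x)) {w : ℂ} (hw : w ∈ D)
    (hwim : 0 < w.im) {y : K} (hy : y ∈ upperSpan D A Γ z₀ F) :
    relResolvent A w y ∈ upperSpan D A Γ z₀ F := by
  have key : ∀ z ∈ D, 0 < z.im → z ≠ w → ∀ h : H,
      relResolvent A w (F (gammaField A z₀ Γ z h)) ∈ upperSpan D A Γ z₀ F := by
    intro z hz hzim hzw h
    have h1 := congrArg F (relResolvent_gammaField z₀ Γ (hD hz) (hD hw) h)
    rw [map_smul, hF w hw, map_sub] at h1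
    have h2 : (z - w) • relResolvent A w (F (gammaField A z₀ Γ z h)) ∈ upperSpan D A Γ z₀ F := by
      rw [h1]
      exact Submodule.sub_mem _ (mem_upperSpan hz hzim h) (mem_upperSpan hw hwim h)
    exact (Submodule.smul_mem_iff _ (sub_ne_zero.mpr hzw)).mp h2
  have key2 : ∀ y ∈ Submodule.span ℂ {y : K | ∃ z ∈ D, 0 < z.im ∧
      ∃ h : H, y = F (gammaField A z₀ Γ z h)}, relResolvent A w y ∈ upperSpan D A Γ z₀ F := by
    intro y hy
    have hle : Submodule.span ℂ {y : K | ∃ z ∈ D, 0 < z.im ∧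
        ∃ h : H, y = F (gammaField A z₀ Γ z h)} ≤
        (upperSpan D A Γ z₀ F).comap (relResolvent A w).toLinearMap := by
      rw [Submodule.span_le]
      rintro _ ⟨z, hz, hzim, h, rfl⟩
      rcases eq_or_ne z w with rfl | hzw
      · have hc : Filter.Tendsto (fun z' => relResolvent A z (F (gammaField A z₀ Γ z' h))) (𝓝[≠] z)
            (𝓝 (relResolvent A z (F (gammaField A z₀ Γ z h)))) :=
          (((relResolvent A z ∘L F).continuous.continuousAt.comp
            (continuousAt_gammaField z₀ Γ (hD hz) h)).tendsto).mono_left nhdsWithin_le_nhds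
        refine isClosed_upperSpan.mem_of_tendsto hc ?_
        have hup : IsOpen {z : ℂ | 0 < z.im} := isOpen_lt continuous_const Complex.continuous_im
        filter_upwards [self_mem_nhdsWithin, nhdsWithin_le_nhds (hDo.mem_nhds hz),
          nhdsWithin_le_nhds (hup.mem_nhds hzim)] with z' h1 h2 h3
        exact key z' h2 h3 h1 h
      · exact key z hz hzim hzw h
    exact hle hy
  have hcl : closure (Submodule.span ℂ {y : K | ∃ z ∈ D, 0 < z.im ∧
      ∃ h : H, y = F (gammaField A z₀ Γ z h)} : Set K) ⊆
      (relResolvent A w) ⁻¹' (upperSpan D A Γ z₀ F) :=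
    closure_minimal key2 (isClosed_upperSpan.preimage (relResolvent A w).continuous)
  exact hcl hy

theorem IsUpperShift.id : IsUpperShift P D A Γ z₀ F 1 :=
  ⟨fun _ _ => rfl, fun _ h => h, fun _ _ _ => rfl⟩

theorem IsUpperShift.comp {V V' : K →L[ℂ] K} (hV : IsUpperShift P D A Γ z₀ F V)
    (hV' : IsUpperShift P D A Γ z₀ F V') : IsUpperShift P D A Γ z₀ F (V ∘L V') where
  isometric x y := by
    rw [ContinuousLinearMap.comp_apply, ContinuousLinearMap.comp_apply, hV.isometric,
      hV'.isometric]
  map_mem y hy := hV.map_mem _ (hV'.map_mem _ hy)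
  commute T hT x := by
    rw [ContinuousLinearMap.comp_apply, ContinuousLinearMap.comp_apply, hV.commute T hT,
      hV'.commute T hT]

/-- A shift commutes with the resolvents, because these commute with each other; hence every other
shift commutes with it. -/
theorem IsUpperShift.comm (hD : D ⊆ relResolventSet A) {V V' : K →L[ℂ] K}
    (hV : IsUpperShift P D A Γ z₀ F V) (hV' : IsUpperShift P D A Γ z₀ F V') (x : K) :
    V (V' x) = V' (V x) := by
  refine hV'.commute V (fun w hw y => ?_) x
  exact (hV.commute (relResolvent A w) (fun w' hw' y => relResolvent_comm (hD hw') (hD hw) y) y).symm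

theorem isUpperShift_cayley (hA : P.IsSelfAdjointRel A) (hDo : IsOpen D)
    (hD : D ⊆ relResolventSet A) (hDc : ∀ z ∈ D, conj z ∈ D)
    (hF : ∀ w ∈ D, ∀ x, F (relResolvent A w x) = relResolvent A w (F x)) {w : ℂ} (hw : w ∈ D)
    (hwim : 0 < w.im) : IsUpperShift P D A Γ z₀ F (cayley A w) where
  isometric := P.form_cayley hA (hD hw) (hD (hDc w hw))
  map_mem y hy := Submodule.add_mem _ hy
    (Submodule.smul_mem _ _ (relResolvent_mem_upperSpan hDo hD hF hw hwim hy))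
  commute T hT x := by
    simp only [cayley_apply, map_add, map_smul, hT w hw]

/-- For Im z < 0 the Cayley transform at conj z maps Γ_z h to Γ_(conj z) h, which lies over the
upper half-plane. -/
theorem exists_isUpperShift_of_nonreal (hA : P.IsSelfAdjointRel A) (hDo : IsOpen D)
    (hD : D ⊆ relResolventSet A) (hDc : ∀ z ∈ D, conj z ∈ D)
    (hF : ∀ w ∈ D, ∀ x, F (relResolvent A w x) = relResolvent A w (F x)) {z : ℂ} (hz : z ∈ D)
    (hzim : z.im ≠ 0) (h : H) : ∃ V, IsUpperShift P D A Γ z₀ F V ∧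
      V (F (gammaField A z₀ Γ z h)) ∈ upperSpan D A Γ z₀ F := by
  rcases hzim.lt_or_gt with hlt | hgt
  · have him : 0 < (conj z).im := by simpa using hlt
    refine ⟨_, isUpperShift_cayley hA hDo hD hDc hF (hDc z hz) him, ?_⟩
    have h1 := congrArg F (relResolvent_gammaField z₀ Γ (hD hz) (hD (hDc z hz)) h)
    rw [map_smul, hF _ (hDc z hz), map_sub] at h1
    have h2 : cayley A (conj z) (F (gammaField A z₀ Γ z h)) = F (gammaField A z₀ Γ (conj z) h) := by
      rw [cayley_apply, Complex.conj_conj, ← neg_sub z, neg_smul, h1]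
      abel
    rw [h2]
    exact mem_upperSpan (hDc z hz) him h
  · exact ⟨1, IsUpperShift.id, mem_upperSpan hz hgt h⟩

theorem exists_isUpperShift_of_mem_span (hA : P.IsSelfAdjointRel A) (hDo : IsOpen D)
    (hD : D ⊆ relResolventSet A) (hDc : ∀ z ∈ D, conj z ∈ D)
    (hF : ∀ w ∈ D, ∀ x, F (relResolvent A w x) = relResolvent A w (F x)) {y : K}
    (hy : y ∈ Submodule.span ℂ {y : K | ∃ z ∈ D, z.im ≠ 0 ∧
      ∃ h : H, y = F (gammaField A z₀ Γ z h)}) :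
    ∃ V, IsUpperShift P D A Γ z₀ F V ∧ V y ∈ upperSpan D A Γ z₀ F := by
  induction hy using Submodule.span_induction with
  | mem x hx =>
    obtain ⟨z, hz, hzim, h, rfl⟩ := hx
    exact exists_isUpperShift_of_nonreal hA hDo hD hDc hF hz hzim h
  | zero => exact ⟨1, IsUpperShift.id, Submodule.zero_mem _⟩
  | add x y _ _ hx hy =>
    obtain ⟨V, hV, hx⟩ := hx
    obtain ⟨V', hV', hy⟩ := hy
    -- Since V and V' commute, each summand can meet its own shift first; the other shift then
    -- preserves the upper span.
    refine ⟨V ∘L V', hV.comp hV', ?_⟩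
    rw [map_add, ContinuousLinearMap.comp_apply, ContinuousLinearMap.comp_apply, hV.comm hD hV' x]
    exact Submodule.add_mem _ (hV'.map_mem _ hx) (hV.map_mem _ hy)
  | smul c x _ hx =>
    obtain ⟨V, hV, hx⟩ := hx
    exact ⟨V, hV, by
      rw [map_smul]
      exact Submodule.smul_mem _ _ hx⟩

theorem exists_isUpperShift_of_finset (hA : P.IsSelfAdjointRel A) (hDo : IsOpen D)
    (hD : D ⊆ relResolventSet A) (hDc : ∀ z ∈ D, conj z ∈ D)
    (hF : ∀ w ∈ D, ∀ x, F (relResolvent A w x) = relResolvent A w (F x)) {ι : Type*}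
    (s : Finset ι) (f : ι → K)
    (hf : ∀ i, f i ∈ Submodule.span ℂ {y : K | ∃ z ∈ D, z.im ≠ 0 ∧
      ∃ h : H, y = F (gammaField A z₀ Γ z h)}) :
    ∃ V, IsUpperShift P D A Γ z₀ F V ∧ ∀ i ∈ s, V (f i) ∈ upperSpan D A Γ z₀ F := by
  classical
  induction s using Finset.induction_on with
  | empty => exact ⟨1, IsUpperShift.id, by simp⟩
  | insert i s _ ih =>
    obtain ⟨V, hV, hs⟩ := ih
    obtain ⟨V', hV', hi⟩ := exists_isUpperShift_of_mem_span hA hDo hD hDc hF (hf i)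
    refine ⟨V ∘L V', hV.comp hV', fun j hj => ?_⟩
    rw [ContinuousLinearMap.comp_apply]
    rcases Finset.mem_insert.mp hj with rfl | hj
    · exact hV.map_mem _ hi
    · rw [hV.comm hD hV']
      exact hV'.map_mem _ (hs j hj)

/-- Minimality can be tested on the non-real points of `D`. -/
theorem IsMinimal.topologicalClosure_nonreal (hmin : IsMinimal A Γ z₀)
    (hDn : ∀ z : ℂ, z.im ≠ 0 → ∀ᶠ w in 𝓝[≠] z, w ∈ D) :
    (Submodule.span ℂ {y : K | ∃ z ∈ D, z.im ≠ 0 ∧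
      ∃ h : H, y = gammaField A z₀ Γ z h}).topologicalClosure = ⊤ := by
  rw [eq_top_iff, ← hmin]
  refine Submodule.topologicalClosure_minimal _ ?_ (Submodule.isClosed_topologicalClosure _)
  rw [Submodule.span_le]
  rintro _ ⟨z, hz, h, rfl⟩
  -- Points of ρ(A) may be real or lie outside D, but non-real points of D accumulate at each of
  -- them and the γ-field is continuous there.
  have hdense : z ∈ closure {w : ℂ | w ∈ D ∧ w.im ≠ 0} := by
    have h1 : Dense {w : ℂ | w.im ≠ 0} := by
      have := (dense_compl_singleton (0 : ℝ)).preimage Complex.isOpenMap_im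
      exact this
    refine closure_minimal (fun w hw => ?_) isClosed_closure (h1 z)
    rw [mem_closure_iff_frequently]
    have hne : ∀ᶠ v in 𝓝[≠] w, v.im ≠ 0 := nhdsWithin_le_nhds
      ((isOpen_ne.preimage Complex.continuous_im).mem_nhds hw)
    exact (((hDn w hw).and hne).frequently).filter_mono nhdsWithin_le_nhds
  have hcl := mem_closure_image (continuousAt_gammaField z₀ Γ hz h) hdense
  refine closure_mono ?_ hcl
  rintro _ ⟨w, ⟨hw, hwim⟩, rfl⟩
  exact Submodule.subset_span ⟨w, hw, hwim, h, rfl⟩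

theorem range_subset_closure_nonreal (hmin : IsMinimal A Γ z₀)
    (hDn : ∀ z : ℂ, z.im ≠ 0 → ∀ᶠ w in 𝓝[≠] z, w ∈ D) (F : K →L[ℂ] K) (x : K) :
    F x ∈ closure (Submodule.span ℂ {y : K | ∃ z ∈ D, z.im ≠ 0 ∧
      ∃ h : H, y = F (gammaField A z₀ Γ z h)} : Set K) := by
  have hx : x ∈ (Submodule.span ℂ {y : K | ∃ z ∈ D, z.im ≠ 0 ∧
      ∃ h : H, y = gammaField A z₀ Γ z h}).topologicalClosure := by
    rw [hmin.topologicalClosure_nonreal hDn]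
    trivial
  refine map_mem_closure F.continuous hx ?_
  intro y hy
  have hle : Submodule.span ℂ {y : K | ∃ z ∈ D, z.im ≠ 0 ∧
      ∃ h : H, y = gammaField A z₀ Γ z h} ≤ (Submodule.span ℂ {y : K | ∃ z ∈ D, z.im ≠ 0 ∧
      ∃ h : H, y = F (gammaField A z₀ Γ z h)}).comap F.toLinearMap := by
    rw [Submodule.span_le]
    rintro _ ⟨z, hz, hzim, h, rfl⟩
    exact Submodule.subset_span ⟨z, hz, hzim, h, rfl⟩
  exact hle hy

/-- The negative squares of `[., .]` on the range of `F` are attained on the linear span of finitely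
many vectors `F Γ_z h` with `z` in the upper half-plane. -/
theorem exists_hasNegDim_span (hA : P.IsSelfAdjointRel A) (hmin : IsMinimal A Γ z₀)
    (hDo : IsOpen D) (hD : D ⊆ relResolventSet A) (hDc : ∀ z ∈ D, conj z ∈ D)
    (hDn : ∀ z : ℂ, z.im ≠ 0 → ∀ᶠ w in 𝓝[≠] z, w ∈ D)
    (hF : ∀ w ∈ D, ∀ x, F (relResolvent A w x) = relResolvent A w (F x)) {n : ℕ}
    (hn : P.HasNegDim (LinearMap.range F.toLinearMap : Set K) n) :
    ∃ (m : ℕ) (z : Fin m → ℂ) (h : Fin m → H), (∀ i, z i ∈ D ∧ 0 < (z i).im) ∧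
      P.HasNegDim (Submodule.span ℂ (Set.range fun i => F (gammaField A z₀ Γ (z i) (h i))) : Set K)
        n := by
  have h1 : P.HasNegDim (Submodule.span ℂ {y : K | ∃ z ∈ D, z.im ≠ 0 ∧
      ∃ h : H, y = F (gammaField A z₀ Γ z h)} : Set K) n := by
    refine KreinSymmetry.HasNegDim.of_closure (hn.mono ?_)
    rintro _ ⟨x, rfl⟩
    exact range_subset_closure_nonreal hmin hDn F x
  obtain ⟨f, hf, hneg⟩ := h1
  obtain ⟨V, hV, hVf⟩ := exists_isUpperShift_of_finset hA hDo hD hDc hF Finset.univ f hf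
  have h2 : P.HasNegDim (Submodule.span ℂ {y : K | ∃ z ∈ D, 0 < z.im ∧
      ∃ h : H, y = F (gammaField A z₀ Γ z h)} : Set K) n :=
    -- One isometry moves the whole finite family into the closed upper span without changing its
    -- Gram matrix; openness then replaces the closure by the span itself.
    KreinSymmetry.HasNegDim.of_closure
      ⟨fun i => V (f i), fun i => hVf i (Finset.mem_univ i), hneg.map hV.isometric⟩
  obtain ⟨g, hg, hneg⟩ := h2
  choose t ht hgt using fun i => Submodule.mem_span_finite_of_mem_span (hg i)
  classical
  let s : Finset K := Finset.univ.biUnion t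
  have hs : ∀ y : s, ∃ z ∈ D, 0 < z.im ∧ ∃ h : H, (y : K) = F (gammaField A z₀ Γ z h) := by
    rintro ⟨y, hy⟩
    obtain ⟨i, -, hi⟩ := Finset.mem_biUnion.mp hy
    exact ht i hi
  choose z hzD hzim h hy using hs
  refine ⟨s.card, fun i => z (s.equivFin.symm i), fun i => h (s.equivFin.symm i),
    fun i => ⟨hzD _, hzim _⟩, g, fun i => ?_, hneg⟩
  refine Submodule.span_mono ?_ (hgt i)
  intro y hyt
  have hys : y ∈ s := Finset.mem_biUnion.mpr ⟨i, Finset.mem_univ i, hyt⟩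
  exact ⟨s.equivFin ⟨y, hys⟩, by simp [← hy]⟩

end Density

end

end GenNevanlinna

namespace GenNevanlinna

noncomputable section

set_option linter.unusedSectionVars false

/-! ### Nilpotent operators with a cyclic vector -/

/-- The vectors `X₀, …, X_{l-1}` span `V`, and `N` maps `X_k` to `X_{k-1}` and `X₀` to `0`. -/
structure IsNilpotentString {V : Type*} [NormedAddCommGroup V] [NormedSpace ℂ V] (N : V →L[ℂ] V)
    {l : ℕ} (X : Fin l → V) : Prop where
  apply_first : ∀ k : Fin l, (k : ℕ) = 0 → N (X k) = 0
  apply_step : ∀ j k : Fin l, (k : ℕ) = (j : ℕ) + 1 → N (X k) = X j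
  span_eq_top : Submodule.span ℂ (Set.range X) = ⊤

namespace IsNilpotentString

variable {V : Type*} [NormedAddCommGroup V] [NormedSpace ℂ V] {N : V →L[ℂ] V} {l : ℕ}
  {X : Fin l → V}

theorem pow_apply (hX : IsNilpotentString N X) (m : ℕ) (j k : Fin l) (h : (k : ℕ) = j + m) :
    (N ^ m) (X k) = X j := by
  induction m generalizing k with
  | zero =>
    have : k = j := Fin.ext (by simpa using h)
    simp [this]
  | succ m ih =>
    rw [pow_succ, mul_apply_eq_comp,
      hX.apply_step ⟨j + m, by omega⟩ k (by simp only; omega)]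
    exact ih _ rfl

theorem pow_length (hX : IsNilpotentString N X) : N ^ l = 0 := by
  ext v
  have hv : v ∈ Submodule.span ℂ (Set.range X) := by
    rw [hX.span_eq_top]
    trivial
  have hle : Submodule.span ℂ (Set.range X) ≤ LinearMap.ker (N ^ l).toLinearMap := by
    rw [Submodule.span_le]
    rintro _ ⟨k, rfl⟩
    have hk := k.2
    have h1 : N ^ l = N ^ (l - k - 1) * (N * N ^ (k : ℕ)) := by
      rw [← pow_succ', ← pow_add]
      congr 1
      omega
    change (N ^ l) (X k) = 0
    rw [h1, mul_apply_eq_comp, mul_apply_eq_comp,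
      hX.pow_apply k ⟨0, by omega⟩ k (by simp), hX.apply_first _ rfl, map_zero]
  exact hle hv

theorem isNilpotent (hX : IsNilpotentString N X) : IsNilpotent N := ⟨l, hX.pow_length⟩

/-- Every string vector except the last is the N-image of its successor, so the last one spans V
modulo the range of N. -/
theorem exists_eq_smul_add (hX : IsNilpotentString N X) {last : Fin l}
    (hlast : (last : ℕ) + 1 = l) (v : V) : ∃ (c : ℂ) (w : V), v = c • X last + N w := by
  have hv : v ∈ Submodule.span ℂ (Set.range X) := by
    rw [hX.span_eq_top]
    trivial
  induction hv using Submodule.span_induction with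
  | mem x hx =>
    obtain ⟨k, rfl⟩ := hx
    by_cases hk : (k : ℕ) + 1 = l
    · have : k = last := Fin.ext (by omega)
      exact ⟨1, 0, by simp [this]⟩
    · have hk2 := k.2
      exact ⟨0, X ⟨k + 1, by omega⟩, by rw [hX.apply_step k _ rfl]; simp⟩
  | zero => exact ⟨0, 0, by simp⟩
  | add x y _ _ hx hy =>
    obtain ⟨c, w, rfl⟩ := hx
    obtain ⟨c', w', rfl⟩ := hy
    exact ⟨c + c', w + w', by rw [map_add]; module⟩
  | smul a x _ hx =>
    obtain ⟨c, w, rfl⟩ := hx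
    exact ⟨a * c, a • w, by rw [map_smul]; module⟩

theorem pow_pred_apply_last (hX : IsNilpotentString N X) {first last : Fin l}
    (hfirst : (first : ℕ) = 0) (hlast : (last : ℕ) + 1 = l) :
    (N ^ (l - 1)) (X last) = X first :=
  hX.pow_apply _ _ _ (by omega)

theorem pow_pred_apply (hX : IsNilpotentString N X) {first last : Fin l}
    (hfirst : (first : ℕ) = 0) (hlast : (last : ℕ) + 1 = l) (c : ℂ) (w : V) :
    (N ^ (l - 1)) (c • X last + N w) = c • X first := by
  rw [map_add, map_smul, hX.pow_pred_apply_last hfirst hlast, ← mul_apply_eq_comp, ← pow_succ,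
    show l - 1 + 1 = l by omega, hX.pow_length]
  simp

theorem exists_eq_add (hX : IsNilpotentString N X) {first last : Fin l}
    (hfirst : (first : ℕ) = 0) (hlast : (last : ℕ) + 1 = l) (h0 : X first ≠ 0) {v : V}
    (hv : (N ^ (l - 1)) v = X first) : ∃ w, v = X last + N w := by
  obtain ⟨c, w, rfl⟩ := hX.exists_eq_smul_add hlast v
  rw [hX.pow_pred_apply hfirst hlast] at hv
  have hc : c = 1 := by
    have h1 : (c - 1) • X first = 0 := by rw [sub_smul, one_smul, hv, sub_self]
    exact sub_eq_zero.mp ((smul_eq_zero.mp h1).resolve_right h0)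
  exact ⟨w, by rw [hc, one_smul]⟩

theorem exists_eq_smul_add' (hX : IsNilpotentString N X) {last : Fin l}
    (hlast : (last : ℕ) + 1 = l) {v w : V} (hv : v = X last + N w) (s : V) :
    ∃ (c : ℂ) (t : V), s = c • v + N t := by
  obtain ⟨c, t, rfl⟩ := hX.exists_eq_smul_add hlast s
  refine ⟨c, t - c • w, ?_⟩
  rw [hv, map_sub, map_smul]
  module

/-- If `v` agrees with the last vector of the string modulo the range of `N`, it is cyclic. -/
theorem span_pow_eq_top (hX : IsNilpotentString N X) {last : Fin l}
    (hlast : (last : ℕ) + 1 = l) {v w : V} (hv : v = X last + N w) :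
    Submodule.span ℂ (Set.range fun k : Fin l => (N ^ (l - 1 - (k : ℕ))) v) = ⊤ := by
  set W := Submodule.span ℂ (Set.range fun k : Fin l => (N ^ (l - 1 - (k : ℕ))) v) with hW
  -- Iterating V = ℂv + NV gives V = W + N^m V; at m = l the second summand is zero.
  have key : ∀ m ≤ l, ∀ s : V, ∃ t ∈ W, ∃ r, s = t + (N ^ m) r := by
    intro m
    induction m with
    | zero => exact fun _ s => ⟨0, W.zero_mem, s, by simp⟩
    | succ m ih =>
      intro hm s
      obtain ⟨t, ht, r, rfl⟩ := ih (by omega) s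
      obtain ⟨c, r', rfl⟩ := hX.exists_eq_smul_add' hlast hv r
      refine ⟨t + c • (N ^ m) v, W.add_mem ht (W.smul_mem _ ?_), r', ?_⟩
      · refine Submodule.subset_span ⟨⟨l - 1 - m, by omega⟩, ?_⟩
        simp only
        congr 2
        omega
      · rw [map_add, map_smul, pow_succ, mul_apply_eq_comp, add_assoc]
  rw [eq_top_iff]
  intro s _
  obtain ⟨t, ht, r, rfl⟩ := key l le_rfl s
  rw [hX.pow_length]
  simpa using ht

end IsNilpotentString

/-! ### Resolvents of nilpotent perturbations of scalars -/

section Nilpotent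

variable {V : Type*} [NormedAddCommGroup V] [NormedSpace ℂ V] {T : V →L[ℂ] V} {α : ℂ}

theorem isUnit_sub_smul_one (hT : IsNilpotent (T - α • (1 : V →L[ℂ] V))) {z : ℂ} (hz : z ≠ α) :
    IsUnit (T - z • (1 : V →L[ℂ] V)) := by
  have h1 : T - z • (1 : V →L[ℂ] V) = (T - α • (1 : V →L[ℂ] V)) + (α - z) • (1 : V →L[ℂ] V) := by
    module
  rw [h1]
  refine hT.isUnit_add_right_of_commute ?_ ?_
  · exact (isUnit_one).smul (Units.mk0 (α - z) (sub_ne_zero.mpr hz.symm))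
  · exact (Commute.one_right _).smul_right _

theorem spectrum_eq_singleton (hT : IsNilpotent (T - α • (1 : V →L[ℂ] V))) {v : V} (hv : v ≠ 0)
    (hTv : (T - α • (1 : V →L[ℂ] V)) v = 0) : spectrum ℂ T = {α} := by
  ext z
  rw [spectrum.mem_iff, Algebra.algebraMap_eq_smul_one, Set.mem_singleton_iff, ← neg_sub,
    IsUnit.neg_iff]
  constructor
  · intro h
    by_contra hz
    exact h (isUnit_sub_smul_one hT hz)
  · rintro rfl hu
    obtain ⟨B, hB⟩ := hu.exists_left_inv
    apply hv
    have := congrArg (fun S : V →L[ℂ] V => S v) hB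
    simpa [mul_apply_eq_comp, hTv] using this.symm

theorem analyticAt_inverse_sub [CompleteSpace V] (hT : IsNilpotent (T - α • (1 : V →L[ℂ] V)))
    {z : ℂ} (hz : z ≠ α) :
    AnalyticAt ℂ (fun w : ℂ => Ring.inverse (T - w • (1 : V →L[ℂ] V))) z := by
  obtain ⟨u, hu⟩ := isUnit_sub_smul_one hT hz
  have h1 : AnalyticAt ℂ (fun w : ℂ => T - w • (1 : V →L[ℂ] V)) z := by fun_prop
  refine AnalyticAt.comp (g := Ring.inverse) ?_ h1
  rw [← hu]
  exact analyticAt_inverse u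

/-- The leading coefficient of the resolvent at its pole. -/
theorem tendsto_pow_smul_inverse {l : ℕ} (hl : 0 < l) (hT : (T - α • (1 : V →L[ℂ] V)) ^ l = 0) :
    Filter.Tendsto (fun z : ℂ => (z - α) ^ l • Ring.inverse (T - z • (1 : V →L[ℂ] V))) (𝓝[≠] α)
      (𝓝 (-(T - α • (1 : V →L[ℂ] V)) ^ (l - 1))) := by
  set N := T - α • (1 : V →L[ℂ] V) with hN
  -- The geometric sum factoring N^l - (z - α)^l through T - z. As N^l = 0, it is -(z - α)^l (T -
  -- z)⁻¹ off α and is continuous at α.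
  let G : ℂ → V →L[ℂ] V := fun z =>
    ∑ i ∈ Finset.range l, N ^ i * ((z - α) • (1 : V →L[ℂ] V)) ^ (l - 1 - i)
  have hG : Continuous G := by
    simp only [G, smul_pow, one_pow]
    fun_prop
  have hGα : G α = N ^ (l - 1) := by
    simp only [G, sub_self, zero_smul]
    rw [Finset.sum_eq_single_of_mem (l - 1) (by simp; omega)]
    · simp
    · intro i hi hne
      rw [zero_pow, mul_zero]
      have := Finset.mem_range.mp hi
      omega
  have heq : ∀ z : ℂ, z ≠ α → (z - α) ^ l • Ring.inverse (T - z • (1 : V →L[ℂ] V)) = -G z := by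
    intro z hz
    have hu := isUnit_sub_smul_one (T := T) (α := α) ⟨l, hT⟩ hz
    have h1 : (T - z • (1 : V →L[ℂ] V)) * G z = -((z - α) ^ l • 1) := by
      have h2 := Commute.mul_geom_sum₂
        (show Commute N ((z - α) • (1 : V →L[ℂ] V)) from (Commute.one_right _).smul_right _) l
      have h3 : T - z • (1 : V →L[ℂ] V) = N - (z - α) • 1 := by
        rw [hN]
        module
      rw [h3]
      rw [hT, smul_pow, one_pow, zero_sub] at h2
      exact h2
    have h2 := congrArg (fun S => Ring.inverse (T - z • (1 : V →L[ℂ] V)) * S) h1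
    simp only [← mul_assoc] at h2
    rw [Ring.inverse_mul_cancel _ hu, one_mul] at h2
    rw [h2]
    simp
  have h1 : Filter.Tendsto (fun z => -G z) (𝓝[≠] α) (𝓝 (-N ^ (l - 1))) := by
    rw [← hGα]
    exact hG.neg.continuousAt.tendsto.mono_left nhdsWithin_le_nhds
  refine h1.congr' ?_
  filter_upwards [self_mem_nhdsWithin] with z hz
  exact (heq z hz).symm

end Nilpotent

/-! ### Jordan chains of self-adjoint relations -/

section Jordan

variable {K : Type*} [NormedAddCommGroup K] [InnerProductSpace ℂ K] [CompleteSpace K]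
  {P : KreinSymmetry K} {A : Submodule ℂ (K × K)} {α : ℂ} {l : ℕ} {x : Fin l → K}
  {S : Submodule ℂ K}

/-- The `[., .]`-orthogonal projection onto a finite-dimensional non-degenerate subspace. -/
theorem KreinSymmetry.exists_orthogonalProjection [FiniteDimensional ℂ S]
    (hS : P.NondegenerateOn S) :
    ∃ E : K →L[ℂ] S, ∀ (y : K) (s : S), P.form (E y) s = P.form y s := by
  let B : K →L[ℂ] S := S.orthogonalProjectionOnto ∘L P.J
  have hB : ∀ (y : K) (s : S), inner ℂ s (B y) = P.form y s := fun y s =>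
    Submodule.inner_orthogonalProjectionOnto_eq_of_mem_left s (P.J y)
  -- The Gram operator of the form on S: non-degeneracy makes it injective, hence invertible in
  -- finite dimension, and its inverse corrects the Hilbert space projection.
  let T : S →ₗ[ℂ] S := B.toLinearMap ∘ₗ S.subtype
  have hT : Function.Injective T := by
    rw [← LinearMap.ker_eq_bot, LinearMap.ker_eq_bot']
    intro s hs
    refine Subtype.ext (hS s s.2 fun t ht => ?_)
    rw [← hB s ⟨t, ht⟩, show B s = 0 from hs, inner_zero_right]
  let e := LinearEquiv.ofInjectiveEndo T hT
  refine ⟨e.symm.toLinearMap.toContinuousLinearMap ∘L B, fun y s => ?_⟩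
  rw [← hB, ← hB]
  congr 1
  exact e.apply_symm_apply (B y)

theorem IsJordanChain.finiteDimensional (hS : S = Submodule.span ℂ (Set.range x)) :
    FiniteDimensional ℂ S := by
  rw [hS]
  exact FiniteDimensional.span_of_finite ℂ (Set.finite_range x)

theorem IsJordanChain.exists_image (hx : IsJordanChain A α x)
    (hS : S = Submodule.span ℂ (Set.range x)) {u : K} (hu : u ∈ S) : ∃ v ∈ S, (u, v) ∈ A := by
  have hxS : ∀ k, x k ∈ S := fun k => hS ▸ Submodule.subset_span ⟨k, rfl⟩
  have hu' : u ∈ Submodule.span ℂ (Set.range x) := hS ▸ hu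
  clear hu
  induction hu' using Submodule.span_induction with
  | mem u h =>
    obtain ⟨k, rfl⟩ := h
    by_cases hk : (k : ℕ) = 0
    · exact ⟨_, S.smul_mem _ (hxS k), (hx.eigenvector k hk).2⟩
    · have := k.2
      exact ⟨_, S.add_mem (S.smul_mem _ (hxS k)) (hxS ⟨k - 1, by omega⟩),
        hx.step _ k (by simp only; omega)⟩
  | zero => exact ⟨0, S.zero_mem, A.zero_mem⟩
  | add u u' _ _ h h' =>
    obtain ⟨v, hv, hA⟩ := h
    obtain ⟨v', hv', hA'⟩ := h'
    exact ⟨v + v', S.add_mem hv hv', A.add_mem hA hA'⟩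
  | smul c u _ h =>
    obtain ⟨v, hv, hA⟩ := h
    exact ⟨c • v, S.smul_mem c hv, A.smul_mem c hA⟩

/-- By self-adjointness the multivalued part of A is orthogonal to its domain, which contains S.
This is why A induces an operator in S. -/
theorem IsJordanChain.eq_zero_of_zero_mem (hx : IsJordanChain A α x)
    (hA : P.IsSelfAdjointRel A) (hnd : P.NondegenerateOn S)
    (hS : S = Submodule.span ℂ (Set.range x)) {v : K} (hv : v ∈ S) (h : ((0 : K), v) ∈ A) :
    v = 0 := by
  refine hnd v hv fun u hu => ?_
  obtain ⟨u', -, hA'⟩ := hx.exists_image hS hu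
  have := (hA _).mp hA' _ h
  simpa using this

theorem IsJordanChain.exists_isInducedOperator (hx : IsJordanChain A α x)
    (hA : P.IsSelfAdjointRel A) (hnd : P.NondegenerateOn S)
    (hS : S = Submodule.span ℂ (Set.range x)) : ∃ T : S →L[ℂ] S, IsInducedOperator A S T := by
  have := IsJordanChain.finiteDimensional hS
  have huniq : ∀ u v v' : S, ((u : K), (v : K)) ∈ A → ((u : K), (v' : K)) ∈ A → v = v' := by
    intro u v v' h h'
    have h1 := hx.eq_zero_of_zero_mem hA hnd hS (v - v').2 (by
      have := A.sub_mem h h'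
      simpa using this)
    exact sub_eq_zero.mp (Subtype.ext h1)
  have hex : ∀ u : S, ∃ v : S, ((u : K), (v : K)) ∈ A := fun u => by
    obtain ⟨v, hv, h⟩ := hx.exists_image hS u.2
    exact ⟨⟨v, hv⟩, h⟩
  choose f hf using hex
  let T : S →ₗ[ℂ] S :=
    { toFun := f
      map_add' := fun u v => huniq _ _ _ (hf _) (A.add_mem (hf u) (hf v))
      map_smul' := fun c u => huniq _ _ _ (hf _) (A.smul_mem c (hf u)) }
  refine ⟨T.toContinuousLinearMap, fun u v => ⟨fun h => huniq _ _ _ (hf u) h, ?_⟩⟩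
  rintro rfl
  exact hf u

theorem IsInducedOperator.symmetric {T : S →L[ℂ] S} (hT : IsInducedOperator A S T)
    (hA : P.IsSelfAdjointRel A) (u v : S) : P.form (T u) v = P.form u (T v) :=
  (hA _).mp ((hT v _).mpr rfl) _ ((hT u _).mpr rfl)

theorem IsInducedOperator.relResolvent_mem {T : S →L[ℂ] S} (hT : IsInducedOperator A S T) {z : ℂ}
    (hz : z ∈ relResolventSet A) (hu : IsUnit (T - z • (1 : S →L[ℂ] S))) (s : S) :
    relResolvent A z s = (Ring.inverse (T - z • (1 : S →L[ℂ] S)) s : S) := by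
  apply relResolvent_eq hz
  set t := Ring.inverse (T - z • (1 : S →L[ℂ] S)) s
  have h1 : T t - z • t = s := by
    have h2 := congrArg (fun B : S →L[ℂ] S => B s) (Ring.mul_inverse_cancel _ hu)
    simpa [mul_apply_eq_comp] using h2
  have h3 : (s : K) + z • (t : K) = (T t : S) := by
    rw [← h1]
    simp
  rw [h3]
  exact (hT _ _).mpr rfl

theorem IsJordanChain.isNilpotentString (hx : IsJordanChain A α x)
    (hS : S = Submodule.span ℂ (Set.range x)) {T : S →L[ℂ] S} (hT : IsInducedOperator A S T) :
    IsNilpotentString (T - α • (1 : S →L[ℂ] S))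
      (fun k => (⟨x k, hS ▸ Submodule.subset_span ⟨k, rfl⟩⟩ : S)) where
  apply_first k hk := by
    have h := (hT ⟨x k, hS ▸ Submodule.subset_span ⟨k, rfl⟩⟩
      (α • ⟨x k, hS ▸ Submodule.subset_span ⟨k, rfl⟩⟩)).mp (hx.eigenvector k hk).2
    simp [h]
  apply_step j k hk := by
    have h := (hT ⟨x k, hS ▸ Submodule.subset_span ⟨k, rfl⟩⟩
      (α • ⟨x k, hS ▸ Submodule.subset_span ⟨k, rfl⟩⟩
        + ⟨x j, hS ▸ Submodule.subset_span ⟨j, rfl⟩⟩)).mp (hx.step j k hk)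
    rw [sub_apply, h]
    exact add_sub_cancel_left _ _
  span_eq_top := by
    apply Submodule.map_injective_of_injective S.injective_subtype
    rw [Submodule.map_span, Submodule.map_subtype_top, ← Set.range_comp]
    exact hS.symm

/-- A vector whose image under the last non-vanishing power is `x₀` generates a maximal
non-degenerate Jordan chain with the same span. -/
theorem IsMaxNondegJordanChain.jordanString (hx : IsMaxNondegJordanChain P A α x)
    (hS : S = Submodule.span ℂ (Set.range x)) {T : S →L[ℂ] S} (hT : IsInducedOperator A S T)
    {first : Fin l} (hfirst : (first : ℕ) = 0) {v : S}
    (hv : ((((T - α • (1 : S →L[ℂ] S)) ^ (l - 1)) v : S) : K) = x first) :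
    IsMaxNondegJordanChain P A α (jordanString T α l v) ∧
      Submodule.span ℂ (Set.range (GenNevanlinna.jordanString T α l v)) = S ∧
      ∀ k : Fin l, (k : ℕ) = 0 → GenNevanlinna.jordanString T α l v k = x k := by
  set N := T - α • (1 : S →L[ℂ] S) with hN
  have hl := hx.isJordanChain.length_pos
  have hX := hx.isJordanChain.isNilpotentString hS hT
  have hlast : ((⟨l - 1, by omega⟩ : Fin l) : ℕ) + 1 = l := by simp only; omega
  have h0 : x first ≠ 0 := (hx.isJordanChain.eigenvector first hfirst).1
  obtain ⟨w, hw⟩ := hX.exists_eq_add hfirst hlast (fun h => h0 (congrArg Subtype.val h))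
    (Subtype.ext hv)
  have hTN : ∀ s : S, T s = α • s + N s := fun s => by simp [hN]
  have hspan : Submodule.span ℂ (Set.range (GenNevanlinna.jordanString T α l v)) = S := by
    have h1 := congrArg (Submodule.map S.subtype) (hX.span_pow_eq_top hlast hw)
    rw [Submodule.map_span, Submodule.map_subtype_top, ← Set.range_comp] at h1
    exact h1
  have hk0 : ∀ k : Fin l, (k : ℕ) = 0 → GenNevanlinna.jordanString T α l v k = x k := by
    intro k hk
    have : k = first := Fin.ext (by omega)
    rw [GenNevanlinna.jordanString, hk, Nat.sub_zero, this]
    exact hv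
  refine ⟨⟨⟨hl, fun k hk => ?_, fun j k hjk => ?_⟩, fun y hy => ?_, ?_⟩, hspan, hk0⟩
  · rw [hk0 k hk]
    exact hx.isJordanChain.eigenvector k hk
  · refine (hT ((N ^ (l - 1 - (k : ℕ))) v)
      (α • (N ^ (l - 1 - (k : ℕ))) v + (N ^ (l - 1 - (j : ℕ))) v)).mpr ?_
    have hk := k.2
    rw [hTN, show l - 1 - (j : ℕ) = l - 1 - k + 1 by omega, pow_succ', mul_apply_eq_comp]
  -- A continuation y of the new chain gives (y, αy + v) ∈ A. With v = x_{l-1} + Nw and (w, αw + Nw)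
  -- ∈ A, subtraction shows that y - w continues the original chain.
  · have h1 := hy.step (Fin.castSucc ⟨l - 1, by omega⟩) (Fin.last l) (by simp; omega)
    rw [Fin.snoc_last, Fin.snoc_castSucc] at h1
    have h2 : GenNevanlinna.jordanString T α l v ⟨l - 1, by omega⟩ = v := by
      simp [GenNevanlinna.jordanString]
    rw [h2] at h1
    have h3 := A.sub_mem h1 ((hT w _).mpr (hTN w))
    apply hx.maximal (y - w)
    refine ⟨by omega, fun k hk => ?_, fun j k hjk => ?_⟩
    · have hk' : k = Fin.castSucc first := Fin.ext (by simp [hk, hfirst])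
      rw [hk', Fin.snoc_castSucc]
      exact hx.isJordanChain.eigenvector first hfirst
    · obtain ⟨j, rfl⟩ : ∃ j', j = Fin.castSucc j' := ⟨⟨j, by omega⟩, rfl⟩
      rw [Fin.snoc_castSucc]
      rcases Fin.eq_castSucc_or_eq_last k with ⟨k, rfl⟩ | rfl
      · rw [Fin.snoc_castSucc]
        exact hx.isJordanChain.step j k hjk
      · have hj : j = ⟨l - 1, by omega⟩ := Fin.ext (by simp at hjk ⊢; omega)
        rw [Fin.snoc_last, hj]
        convert h3 using 1
        rw [hw]
        ext
        · simp
        · simp only [Submodule.coe_add, Submodule.coe_smul, Prod.snd_sub]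
          module
  · rw [hspan, hS]
    exact hx.nondegenerate

/-- As α is real, the eigenvector x₀ is orthogonal to the range of T - α, and S is spanned by v and
that range. If also [x₀, v] = 0, then x₀ would be isotropic in S. -/
theorem IsMaxNondegJordanChain.form_ne_zero (hx : IsMaxNondegJordanChain P A α x)
    (hA : P.IsSelfAdjointRel A) (hα : conj α = α)
    (hS : S = Submodule.span ℂ (Set.range x)) {T : S →L[ℂ] S} (hT : IsInducedOperator A S T)
    {first : Fin l} (hfirst : (first : ℕ) = 0) {v : S}
    (hv : ((((T - α • (1 : S →L[ℂ] S)) ^ (l - 1)) v : S) : K) = x first) :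
    P.form (x first) v ≠ 0 := by
  intro h
  have hl := hx.isJordanChain.length_pos
  have hX := hx.isJordanChain.isNilpotentString hS hT
  have hlast : ((⟨l - 1, by omega⟩ : Fin l) : ℕ) + 1 = l := by simp only; omega
  have h0 : x first ≠ 0 := (hx.isJordanChain.eigenvector first hfirst).1
  obtain ⟨w, hw⟩ := hX.exists_eq_add hfirst hlast (fun h => h0 (congrArg Subtype.val h))
    (Subtype.ext hv)
  have hnd : P.NondegenerateOn S := hS ▸ hx.nondegenerate
  have hmem : x first ∈ S := hS ▸ Submodule.subset_span ⟨first, rfl⟩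
  refine h0 (hnd _ hmem fun s hs => ?_)
  obtain ⟨c, t, hct⟩ := hX.exists_eq_smul_add' hlast hw ⟨s, hs⟩
  have hs' : s = c • (v : K) + ((T t : S) - α • (t : K)) := by
    simpa using congrArg Subtype.val hct
  have h1 := (hA _).mp ((hT t _).mpr rfl) _ (hx.isJordanChain.eigenvector first hfirst).2
  rw [KreinSymmetry.form_smul_left] at h1
  simp only [hs', KreinSymmetry.form_add_right, KreinSymmetry.form_smul_right,
    KreinSymmetry.form_sub_right, h, ← h1, hα]
  ring

end Jordan

end

end GenNevanlinna

namespace GenNevanlinna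

noncomputable section

set_option linter.unusedSectionVars false

variable {H K : Type*} [NormedAddCommGroup H] [InnerProductSpace ℂ H] [CompleteSpace H]
  [NormedAddCommGroup K] [InnerProductSpace ℂ K] [CompleteSpace K]
  {P : KreinSymmetry K} {A : Submodule ℂ (K × K)} {Γ : H →L[ℂ] K} {z₀ : ℂ} {D : Set ℂ}
  {Q : ℂ → H →L[ℂ] H}

/-! ### Nevanlinna kernels as Gram kernels -/

theorem sub_conj_ne_zero {z w : ℂ} (hz : 0 < z.im) (hw : 0 < w.im) : z - conj w ≠ 0 := fun h => by
  have := congrArg Complex.im h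
  simp only [Complex.sub_im, Complex.conj_im, Complex.zero_im] at this
  linarith

theorem nevanlinnaMatrix_apply {n : ℕ} (Q : ℂ → H →L[ℂ] H) (z : Fin n → ℂ) (h : Fin n → H)
    (i j : Fin n) : nevanlinnaMatrix Q z h i j = (z i - conj (z j))⁻¹ *
      (inner ℂ (h j) (Q (z i) (h i)) -
        inner ℂ (h j) (ContinuousLinearMap.adjoint (Q (z j)) (h i))) := by
  simp only [nevanlinnaMatrix, nevanlinnaKernel, smul_apply, sub_apply, inner_smul_right,
    inner_sub_right]

/-- If the Nevanlinna kernel of `Q` is the Gram kernel of vectors `u z h` in `W` which exhaust the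
negative squares of `[., .]` on `W`, then it has as many negative squares as `W`. -/
theorem negSquares_of_gram {u : ℂ → H → K} {W : Set K}
    (hu : ∀ z ∈ D, ∀ w ∈ D, ∀ h h' : H, inner ℂ h' (Q z h) -
      inner ℂ h' (ContinuousLinearMap.adjoint (Q w) h) = (z - conj w) * P.form (u z h) (u w h'))
    {n : ℕ} (hmax : ∀ m, P.HasNegDim W m → m ≤ n)
    (huW : ∀ (m : ℕ) (z : Fin m → ℂ) (h : Fin m → H), (∀ i, z i ∈ D) →
      (Submodule.span ℂ (Set.range fun i => u (z i) (h i)) : Set K) ⊆ W)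
    (hex : ∃ (m : ℕ) (z : Fin m → ℂ) (h : Fin m → H), (∀ i, z i ∈ D ∧ 0 < (z i).im) ∧
      P.HasNegDim (Submodule.span ℂ (Set.range fun i => u (z i) (h i)) : Set K) n) :
    (∀ (m : ℕ) (z : Fin m → ℂ) (h : Fin m → H),
      (∀ i, z i ∈ D ∧ 0 < (z i).im) → numNegEigenvalues Q z h ≤ n) ∧
    ∃ (m : ℕ) (z : Fin m → ℂ) (h : Fin m → H),
      (∀ i, z i ∈ D ∧ 0 < (z i).im) ∧ numNegEigenvalues Q z h = n := by
  have hM : ∀ (m : ℕ) (z : Fin m → ℂ) (h : Fin m → H), (∀ i, z i ∈ D ∧ 0 < (z i).im) →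
      ∀ i j, nevanlinnaMatrix Q z h i j = P.form (u (z i) (h i)) (u (z j) (h j)) := by
    intro m z h hz i j
    rw [nevanlinnaMatrix_apply, hu _ (hz i).1 _ (hz j).1,
      inv_mul_cancel_left₀ (sub_conj_ne_zero (hz i).2 (hz j).2)]
  have hle : ∀ (m : ℕ) (z : Fin m → ℂ) (h : Fin m → H),
      (∀ i, z i ∈ D ∧ 0 < (z i).im) → numNegEigenvalues Q z h ≤ n := fun m z h hz =>
    hmax _ ((P.hasNegDim_of_gram _ (nevanlinnaMatrix_isHermitian Q z h) (hM m z h hz)).mono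
      (huW m z h fun i => (hz i).1))
  obtain ⟨m, z, h, hz, hneg⟩ := hex
  exact ⟨hle, m, z, h, hz, le_antisymm (hle m z h hz)
    (hneg.le_card_of_gram (nevanlinnaMatrix_isHermitian Q z h) (hM m z h hz))⟩

theorem inner_plusAdjoint (Γ : H →L[ℂ] K) (k : K) (h : H) :
    inner ℂ h (P.plusAdjoint Γ k) = P.form k (Γ h) := by
  simp [KreinSymmetry.plusAdjoint, KreinSymmetry.form, ContinuousLinearMap.adjoint_inner_right]

theorem inner_plusAdjointOn {S : Submodule ℂ K} (Γ : H →L[ℂ] S) (s : S) (h : H) :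
    inner ℂ h (P.plusAdjointOn Γ s) = P.form s (Γ h) :=
  inner_plusAdjoint (S.subtypeL ∘L Γ) s h

theorem inner_adjoint_eq_conj (T : H →L[ℂ] H) (h h' : H) :
    inner ℂ h' (ContinuousLinearMap.adjoint T h) = conj (inner ℂ h (T h')) := by
  rw [ContinuousLinearMap.adjoint_inner_right, inner_conj_symm]

theorem IsRepresentedBy.kernel_eq (hrep : IsRepresentedBy D Q P A Γ z₀)
    (hDc : ∀ z ∈ D, conj z ∈ D) {z w : ℂ} (hz : z ∈ D) (hw : w ∈ D) (h h' : H) :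
    inner ℂ h' (Q z h) - inner ℂ h' (ContinuousLinearMap.adjoint (Q w) h)
      = (z - conj w) * P.form (gammaField A z₀ Γ z h) (gammaField A z₀ Γ w h') := by
  have hρ := hrep.domain_subset
  have key : ∀ v ∈ D, ∀ g g' : H, inner ℂ g' (Q v g) = conj (inner ℂ g (Q z₀ g')) +
      (v - conj z₀) * P.form (gammaField A z₀ Γ v g) (Γ g') := by
    intro v hv g g'
    conv_lhs => rw [hrep.eq_on v hv]
    rw [add_apply, inner_add_right, inner_adjoint_eq_conj, smul_apply, inner_smul_right,
      ContinuousLinearMap.comp_apply, inner_plusAdjoint]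
  have k1 := key z hz h h'
  have k2 := congrArg conj (key w hw h' h)
  -- At z₀ the formula compares Q(z₀) with its adjoint; this eliminates the constant term and leaves
  -- only the resolvent identity.
  have k3 := key z₀ hrep.base_mem h h'
  have r1 := congrArg (fun v => P.form v (Γ h'))
    (relResolvent_sub (hρ hz) (hρ (hDc w hw)) (Γ h))
  have r2 := P.form_relResolvent hrep.isSelfAdjointRel (hρ (hDc w hw)) (by simpa using hρ hw)
    (relResolvent A z (Γ h)) (Γ h')
  have r3 := P.form_relResolvent hrep.isSelfAdjointRel (hρ (hDc w hw)) (by simpa using hρ hw)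
    (Γ h) (Γ h')
  simp only [Complex.conj_conj, KreinSymmetry.form_smul_left, KreinSymmetry.form_sub_left]
    at r1 r2 r3
  rw [r2, r3] at r1
  rw [inner_adjoint_eq_conj, k1, k2]
  simp only [gammaField_apply, map_add, map_mul, map_sub, Complex.conj_conj,
    KreinSymmetry.form_add_left, KreinSymmetry.form_add_right, KreinSymmetry.form_smul_left,
    KreinSymmetry.form_smul_right, KreinSymmetry.conj_form, sub_self, zero_mul, add_zero] at k3 ⊢
  rw [k3]
  linear_combination (-(z - z₀) * (conj w - conj z₀)) * r1

/-! ### The function `Γ₁⁺ (T - z)⁻¹ Γ₁` -/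

section Pole

variable {S : Submodule ℂ K} {T : S →L[ℂ] S} {Γ₁ : H →L[ℂ] S} {α : ℂ}

/-- The function `z ↦ Γ₁⁺ (T - z)⁻¹ Γ₁`. -/
def poleFunction (P : KreinSymmetry K) (T : S →L[ℂ] S) (Γ₁ : H →L[ℂ] S) (z : ℂ) : H →L[ℂ] H :=
  P.plusAdjointOn Γ₁ ∘L Ring.inverse (T - z • (1 : S →L[ℂ] S)) ∘L Γ₁

theorem inner_poleFunction (z : ℂ) (h h' : H) : inner ℂ h' (poleFunction P T Γ₁ z h)
    = P.form (Ring.inverse (T - z • (1 : S →L[ℂ] S)) (Γ₁ h) : S) (Γ₁ h') := by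
  rw [poleFunction, ContinuousLinearMap.comp_apply, ContinuousLinearMap.comp_apply,
    inner_plusAdjointOn]

theorem apply_inverse_apply {z : ℂ} (hz : IsUnit (T - z • (1 : S →L[ℂ] S))) (s : S) :
    T (Ring.inverse (T - z • (1 : S →L[ℂ] S)) s)
      = s + z • Ring.inverse (T - z • (1 : S →L[ℂ] S)) s := by
  have h2 := congrArg (fun B : S →L[ℂ] S => B s) (Ring.mul_inverse_cancel _ hz)
  simp only [mul_apply_eq_comp, sub_apply, smul_apply, one_apply_eq_self] at h2
  rw [sub_eq_iff_eq_add] at h2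
  exact h2

theorem poleFunction_kernel_eq (hT : ∀ u v : S, P.form (T u) v = P.form u (T v)) {z w : ℂ}
    (hz : IsUnit (T - z • (1 : S →L[ℂ] S))) (hw : IsUnit (T - w • (1 : S →L[ℂ] S))) (h h' : H) :
    inner ℂ h' (poleFunction P T Γ₁ z h) -
        inner ℂ h' (ContinuousLinearMap.adjoint (poleFunction P T Γ₁ w) h)
      = (z - conj w) * P.form (Ring.inverse (T - z • (1 : S →L[ℂ] S)) (Γ₁ h) : S)
        (Ring.inverse (T - w • (1 : S →L[ℂ] S)) (Γ₁ h') : S) := by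
  rw [inner_adjoint_eq_conj, inner_poleFunction, inner_poleFunction, KreinSymmetry.conj_form]
  have h1 := apply_inverse_apply hz (Γ₁ h)
  have h2 := apply_inverse_apply hw (Γ₁ h')
  have h3 := hT (Ring.inverse (T - z • (1 : S →L[ℂ] S)) (Γ₁ h))
    (Ring.inverse (T - w • (1 : S →L[ℂ] S)) (Γ₁ h'))
  rw [h1, h2] at h3
  simp only [Submodule.coe_add, Submodule.coe_smul, KreinSymmetry.form_add_left,
    KreinSymmetry.form_add_right, KreinSymmetry.form_smul_left,
    KreinSymmetry.form_smul_right] at h3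
  linear_combination (-1 : ℂ) * h3

theorem adjoint_poleFunction (hT : ∀ u v : S, P.form (T u) v = P.form u (T v)) {z : ℂ}
    (hz : IsUnit (T - z • (1 : S →L[ℂ] S))) (hz' : IsUnit (T - conj z • (1 : S →L[ℂ] S))) :
    ContinuousLinearMap.adjoint (poleFunction P T Γ₁ (conj z)) = poleFunction P T Γ₁ z := by
  ext h
  refine ext_inner_left ℂ fun h' => ?_
  have := poleFunction_kernel_eq (Γ₁ := Γ₁) hT hz hz' h h'
  rw [Complex.conj_conj, sub_self, zero_mul, sub_eq_zero] at this
  exact this.symm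

variable [FiniteDimensional ℂ S]

theorem analyticAt_poleFunction (hT : IsNilpotent (T - α • (1 : S →L[ℂ] S))) {z : ℂ}
    (hz : z ≠ α) : AnalyticAt ℂ (poleFunction P T Γ₁) z := by
  have := FiniteDimensional.complete ℂ S
  have h1 := analyticAt_inverse_sub hT hz
  let L : (S →L[ℂ] S) →L[ℂ] (H →L[ℂ] H) :=
    (ContinuousLinearMap.compL ℂ H S H (P.plusAdjointOn Γ₁)) ∘L
      ((ContinuousLinearMap.compL ℂ H S S).flip Γ₁)
  exact (L.analyticAt _).comp h1

/-- A holomorphic continuation at α would force (z - α)^l Q₁(z) → 0, whereas the limit is -Γ₁⁺ (T -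
α)^(l-1) Γ₁, which has a non-zero matrix element by hypothesis. -/
theorem sigma_poleFunction {l : ℕ} (hl : 0 < l) (hT : (T - α • (1 : S →L[ℂ] S)) ^ l = 0) {h h' : H}
    (hne : P.form (((T - α • (1 : S →L[ℂ] S)) ^ (l - 1)) (Γ₁ h) : S) (Γ₁ h') ≠ 0) :
    sigma {α}ᶜ (poleFunction P T Γ₁) = {α} := by
  ext w
  rw [Set.mem_singleton_iff]
  constructor
  · intro hw
    by_contra hne'
    exact hw ⟨_, analyticAt_poleFunction ⟨l, hT⟩ hne', Filter.Eventually.of_forall fun _ => rfl⟩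
  · rintro rfl ⟨g, hg, hgQ⟩
    have h1 : Filter.Tendsto (fun z => (z - w) ^ l * inner ℂ h' (g z h)) (𝓝[≠] w) (𝓝 0) := by
      have hc : ContinuousAt (fun z => (z - w) ^ l * inner ℂ h' (g z h)) w := by
        have hg' := hg.continuousAt
        have hgh : ContinuousAt (fun z => g z h) w := hg'.clm_apply continuousAt_const
        have : ContinuousAt (fun z => inner ℂ h' (g z h)) w := ContinuousAt.inner continuousAt_const hgh
        fun_prop
      have := hc.tendsto
      rw [sub_self, zero_pow hl.ne', zero_mul] at this
      exact this.mono_left nhdsWithin_le_nhds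
    have h2 := tendsto_pow_smul_inverse hl hT
    have hc : Continuous fun B : S →L[ℂ] S => P.form (B (Γ₁ h) : S) (Γ₁ h') := by
      unfold KreinSymmetry.form
      fun_prop
    have h3 := (hc.tendsto _).comp h2
    have h4 : Filter.Tendsto (fun z => (z - w) ^ l * inner ℂ h' (g z h)) (𝓝[≠] w)
        (𝓝 (P.form (((-(T - w • (1 : S →L[ℂ] S)) ^ (l - 1)) (Γ₁ h) : S) : K) (Γ₁ h'))) := by
      refine h3.congr' ?_
      filter_upwards [hgQ] with z hz
      rw [hz, inner_poleFunction]
      simp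
    have h5 := tendsto_nhds_unique h1 h4
    apply hne
    have h6 : ((-(T - w • (1 : S →L[ℂ] S)) ^ (l - 1)) (Γ₁ h) : S)
        = (-1 : ℂ) • ((T - w • (1 : S →L[ℂ] S)) ^ (l - 1)) (Γ₁ h) := by simp
    rw [h6, Submodule.coe_smul, KreinSymmetry.form_smul_left] at h5
    simpa using h5.symm

end Pole

/-! ### Compression of the representation to a Jordan chain -/

section Compression

variable {S : Submodule ℂ K} {T : S →L[ℂ] S} {E : K →L[ℂ] S} {α : ℂ}

theorem KreinSymmetry.NondegenerateOn.proj_apply_coe (hnd : P.NondegenerateOn S)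
    (hE : ∀ (y : K) (s : S), P.form (E y) s = P.form y s) (s : S) : E s = s := by
  have h := hnd (E s - s : S) (E s - s : S).2 fun v hv => by
    have := hE s ⟨v, hv⟩
    simp only [Submodule.coe_sub, form_sub_left]
    exact sub_eq_zero.mpr this
  exact sub_eq_zero.mp (Subtype.ext h)

theorem KreinSymmetry.NondegenerateOn.isOrthogonalProjection (hnd : P.NondegenerateOn S)
    (hE : ∀ (y : K) (s : S), P.form (E y) s = P.form y s) :
    P.IsOrthogonalProjection S (S.subtypeL ∘L E) where
  idempotent := by
    ext y
    exact congrArg Subtype.val (hnd.proj_apply_coe hE (E y))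
  range_eq := by
    ext y
    constructor
    · rintro ⟨k, rfl⟩
      exact (E k).2
    · intro hy
      exact ⟨y, congrArg Subtype.val (hnd.proj_apply_coe hE ⟨y, hy⟩)⟩
  symmetric y y' := by
    have h1 := hE y (E y')
    have h2 := congrArg conj (hE y' (E y))
    rw [conj_form, conj_form] at h2
    exact h2.symm.trans h1

/-- Tested against v ∈ S, the resolvent moves to the other side as the resolvent at conj z, which
keeps v in S; there the projection can be dropped. -/
theorem proj_relResolvent (hA : P.IsSelfAdjointRel A) (hnd : P.NondegenerateOn S)
    (hE : ∀ (y : K) (s : S), P.form (E y) s = P.form y s) (hT : IsInducedOperator A S T)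
    {z : ℂ} (hz : z ∈ relResolventSet A) (hz' : conj z ∈ relResolventSet A)
    (hu : IsUnit (T - z • (1 : S →L[ℂ] S))) (hu' : IsUnit (T - conj z • (1 : S →L[ℂ] S)))
    (y : K) : E (relResolvent A z y) = Ring.inverse (T - z • (1 : S →L[ℂ] S)) (E y) := by
  apply sub_eq_zero.mp
  refine Subtype.ext (hnd _ (E (relResolvent A z y) - _ : S).2 fun v hv => ?_)
  rw [Submodule.coe_sub, KreinSymmetry.form_sub_left, hE _ ⟨v, hv⟩,
    ← hT.relResolvent_mem hz hu, P.form_relResolvent hA hz hz', P.form_relResolvent hA hz hz']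
  have h1 := hT.relResolvent_mem hz' hu' ⟨v, hv⟩
  simp only at h1
  rw [h1, hE, sub_self]

theorem inverse_apply_sub {z : ℂ} (hu : IsUnit (T - z • (1 : S →L[ℂ] S))) (z₀ : ℂ) (s : S) :
    Ring.inverse (T - z • (1 : S →L[ℂ] S)) ((T - z₀ • (1 : S →L[ℂ] S)) s)
      = s + (z - z₀) • Ring.inverse (T - z • (1 : S →L[ℂ] S)) s := by
  have h1 : T - z₀ • (1 : S →L[ℂ] S) = (T - z • (1 : S →L[ℂ] S)) + (z - z₀) • 1 := by module
  have h2 := congrArg (fun B : S →L[ℂ] S => B s) (Ring.inverse_mul_cancel _ hu)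
  simp only [mul_apply_eq_comp, one_apply_eq_self] at h2
  conv_lhs => rw [h1]
  rw [add_apply, map_add, h2, smul_apply, map_smul, one_apply_eq_self]

/-- T - z is N + (α - z) with N = T - α, and N^(l-1) annihilates the range of N. -/
theorem pow_pred_apply_sub {l : ℕ} (hl : 0 < l) (hN : (T - α • (1 : S →L[ℂ] S)) ^ l = 0) (z : ℂ)
    (s : S) : ((T - α • (1 : S →L[ℂ] S)) ^ (l - 1)) ((T - z • (1 : S →L[ℂ] S)) s)
      = (α - z) • ((T - α • (1 : S →L[ℂ] S)) ^ (l - 1)) s := by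
  have h1 : T - z • (1 : S →L[ℂ] S) = (T - α • (1 : S →L[ℂ] S)) + (α - z) • 1 := by module
  rw [h1, add_apply, map_add, ← mul_apply_eq_comp, ← pow_succ, Nat.sub_add_cancel hl, hN, smul_apply,
    map_smul, one_apply_eq_self, zero_apply, zero_add]

end Compression

end

end GenNevanlinna

/-! ### Splitting of `Q` and of its negative squares along the Jordan chain -/

namespace GenNevanlinna

noncomputable section

set_option linter.unusedSectionVars false

variable {H K : Type*} [NormedAddCommGroup H] [InnerProductSpace ℂ H] [CompleteSpace H]
  [NormedAddCommGroup K] [InnerProductSpace ℂ K] [CompleteSpace K]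
  {P : KreinSymmetry K} {A : Submodule ℂ (K × K)} {Γ : H →L[ℂ] K} {z₀ : ℂ} {D : Set ℂ}
  {Q : ℂ → H →L[ℂ] H} {κ : ℕ}

/-- For a minimal representation, `κ` is the number of negative squares of the whole space. -/
theorem IsGenNevanlinna.hasNegDim_univ (hQ : IsGenNevanlinna D Q κ)
    (hrep : IsRepresentedBy D Q P A Γ z₀) (hmin : IsMinimal A Γ z₀) :
    P.HasNegDim Set.univ κ ∧ ∀ m, P.HasNegDim Set.univ m → m ≤ κ := by
  obtain ⟨n, hn, hmax⟩ := KreinSymmetry.exists_maximal_hasNegDim hrep.isPontryagin Set.univ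
  have hn' : P.HasNegDim (LinearMap.range (1 : K →L[ℂ] K).toLinearMap : Set K) n := by
    refine hn.mono ?_
    intro y _
    exact ⟨y, rfl⟩
  have hex := exists_hasNegDim_span (F := 1) (D := D) hrep.isSelfAdjointRel hmin hQ.isOpen_domain
    hrep.domain_subset hQ.domain_symm hQ.domain_nonreal (fun _ _ _ => rfl) hn'
  obtain ⟨hle, m, z, h, hz, heq⟩ := negSquares_of_gram (Q := Q)
    (fun z hz w hw h h' => hrep.kernel_eq hQ.domain_symm hz hw h h') hmax
    (fun _ _ _ _ => Set.subset_univ _) hex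
  obtain ⟨m', z', h', hz', heq'⟩ := hQ.negSquares_eq
  -- Both numbers are attained maxima of the same count of negative eigenvalues.
  have : n = κ := le_antisymm (heq ▸ hQ.negSquares_le m z h hz) (heq' ▸ hle m' z' h' hz')
  exact this ▸ ⟨hn, hmax⟩

section Decomposition

variable {S : Submodule ℂ K} {T : S →L[ℂ] S} {E : K →L[ℂ] S} {α : ℂ}

/-- This explains the factor T - z₀ in Γ₁: it turns (T - z)⁻¹ Γ₁ into the compressed γ-field. -/
theorem proj_gammaField (hA : P.IsSelfAdjointRel A) (hnd : P.NondegenerateOn S)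
    (hE : ∀ (y : K) (s : S), P.form (E y) s = P.form y s) (hT : IsInducedOperator A S T)
    {z : ℂ} (hz : z ∈ relResolventSet A) (hz' : conj z ∈ relResolventSet A)
    (hu : IsUnit (T - z • (1 : S →L[ℂ] S))) (hu' : IsUnit (T - conj z • (1 : S →L[ℂ] S)))
    (h : H) : Ring.inverse (T - z • (1 : S →L[ℂ] S))
      (((T - z₀ • (1 : S →L[ℂ] S)) ∘L E ∘L Γ) h) = E (gammaField A z₀ Γ z h) := by
  rw [ContinuousLinearMap.comp_apply, inverse_apply_sub hu, gammaField_apply, map_add, map_smul,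
    proj_relResolvent hA hnd hE hT hz hz' hu hu', ContinuousLinearMap.comp_apply]

/-- The decomposition of `Q` along a finite-dimensional non-degenerate subspace on which `A` induces
an operator with the single eigenvalue `α`. -/
theorem exists_decomposition (hQ : IsGenNevanlinna D Q κ)
    (hrep : IsRepresentedBy D Q P A Γ z₀) (hmin : IsMinimal A Γ z₀) [FiniteDimensional ℂ S]
    (hnd : P.NondegenerateOn S) (hE : ∀ (y : K) (s : S), P.form (E y) s = P.form y s)
    (hT : IsInducedOperator A S T) (hα : conj α = α) (hαD : α ∉ D)
    (hN : IsNilpotent (T - α • (1 : S →L[ℂ] S))) {Γ₁ : H →L[ℂ] S}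
    (hΓ₁ : Γ₁ = (T - z₀ • (1 : S →L[ℂ] S)) ∘L E ∘L Γ) :
    ∃ κ₁ κ₂ : ℕ, IsGenNevanlinna {α}ᶜ (poleFunction P T Γ₁) κ₁ ∧
      IsGenNevanlinna D (fun z => Q z - poleFunction P T Γ₁ z) κ₂ ∧ κ₁ + κ₂ = κ := by
  have hA := hrep.isSelfAdjointRel
  have hρ := hrep.domain_subset
  have hDc := hQ.domain_symm
  have hne : ∀ z ∈ D, z ≠ α := fun z hz h => hαD (h ▸ hz)
  have hu : ∀ z : ℂ, z ≠ α → IsUnit (T - z • (1 : S →L[ℂ] S)) := fun z hz =>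
    isUnit_sub_smul_one hN hz
  have hconj : ∀ z : ℂ, z ≠ α → conj z ≠ α := fun z hz h => hz <| by
    rw [← Complex.conj_conj z, h, hα]
  have hsymm := fun u v : S => hT.symmetric hA u v
  have hproj := hnd.isOrthogonalProjection hE
  set F : K →L[ℂ] K := S.subtypeL ∘L E with hFdef
  have hFR : ∀ w ∈ D, ∀ y, F (relResolvent A w y) = relResolvent A w (F y) := by
    intro w hw y
    have hw' := hne w hw
    change ((E (relResolvent A w y) : S) : K) = relResolvent A w (E y)
    rw [proj_relResolvent hA hnd hE hT (hρ hw) (hρ (hDc w hw)) (hu w hw') (hu _ (hconj w hw')),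
      hT.relResolvent_mem (hρ hw) (hu w hw')]
  have hFR' : ∀ w ∈ D, ∀ y, (1 - F) (relResolvent A w y) = relResolvent A w ((1 - F) y) := by
    intro w hw y
    simp only [sub_apply, one_apply_eq_self, map_sub, hFR w hw]
  have hvec : ∀ z ∈ D, ∀ h : H, ((Ring.inverse (T - z • (1 : S →L[ℂ] S)) (Γ₁ h) : S) : K)
      = F (gammaField A z₀ Γ z h) := by
    intro z hz h
    have hz' := hne z hz
    rw [hΓ₁, proj_gammaField hA hnd hE hT (hρ hz) (hρ (hDc z hz)) (hu z hz') (hu _ (hconj z hz'))]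
    rfl
  obtain ⟨n₁, hn₁, hmax₁⟩ := KreinSymmetry.exists_maximal_hasNegDim hrep.isPontryagin
    (LinearMap.range F.toLinearMap : Set K)
  obtain ⟨n₂, hn₂, hmax₂⟩ := KreinSymmetry.exists_maximal_hasNegDim hrep.isPontryagin
    (LinearMap.range (1 - F).toLinearMap : Set K)
  obtain ⟨hκ, hκmax⟩ := hQ.hasNegDim_univ hrep hmin
  have hadd := KreinSymmetry.maximal_hasNegDim_add hproj.idempotent hproj.symmetric hn₁ hmax₁ hn₂
    hmax₂ hκ hκmax
  have han : ∀ z : ℂ, z ≠ α → AnalyticAt ℂ (poleFunction P T Γ₁) z := fun z hz =>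
    analyticAt_poleFunction hN hz
  have hreal : ∀ z : ℂ, z.im ≠ 0 → z ≠ α := by
    rintro z hz rfl
    exact hz (Complex.conj_eq_iff_im.mp hα)
  have hadj : ∀ z : ℂ, z ≠ α →
      ContinuousLinearMap.adjoint (poleFunction P T Γ₁ (conj z)) = poleFunction P T Γ₁ z :=
    fun z hz => adjoint_poleFunction hsymm (hu z hz) (hu _ (hconj z hz))
  have hmero : MeromorphicOn (poleFunction P T Γ₁) {z : ℂ | z.im ≠ 0} := fun z hz =>
    (han z (hreal z hz)).meromorphicAt
  refine ⟨n₁, n₂, ?_, ?_, hadd⟩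
  · have hneg := negSquares_of_gram (P := P) (Q := poleFunction P T Γ₁) (D := {α}ᶜ)
      (W := (LinearMap.range F.toLinearMap : Set K)) (n := n₁)
      (u := fun z h => (Ring.inverse (T - z • (1 : S →L[ℂ] S)) (Γ₁ h) : S))
      (fun z hz w hw h h' => poleFunction_kernel_eq hsymm (hu z hz) (hu w hw) h h') hmax₁
      (fun m z h _ => by
        rw [hproj.range_eq, SetLike.coe_subset_coe, Submodule.span_le]
        rintro _ ⟨i, rfl⟩
        exact Subtype.coe_prop _)
      (by
        -- The domain of the pole function is larger than D, but points of D already exhaust the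
        -- negative squares.
        obtain ⟨m, z, h, hz, hm⟩ := exists_hasNegDim_span hA hmin hQ.isOpen_domain hρ hDc
          hQ.domain_nonreal hFR hn₁
        refine ⟨m, z, h, fun i => ⟨hne _ (hz i).1, (hz i).2⟩, ?_⟩
        simpa only [hvec _ (hz _).1] using hm)
    exact
      { isOpen_domain := isOpen_compl_singleton
        analytic := fun z hz => han z hz
        domain_nonreal := fun z hz =>
          nhdsWithin_le_nhds (isOpen_compl_singleton.mem_nhds (hreal z hz))
        meromorphic := hmero
        domain_symm := fun z hz => hconj z hz
        symm := fun z hz => hadj z hz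
        negSquares_le := hneg.1
        negSquares_eq := hneg.2 }
  · have hneg := negSquares_of_gram (Q := fun z => Q z - poleFunction P T Γ₁ z) (D := D)
      (u := fun z h => (1 - F) (gammaField A z₀ Γ z h))
      (fun z hz w hw h h' => by
        -- As F is a symmetric idempotent, the Gram kernel of (1 - F) Γ_z is that of Γ_z minus that
        -- of F Γ_z.
        have k1 := hrep.kernel_eq hDc hz hw h h'
        have k2 := poleFunction_kernel_eq (P := P) (Γ₁ := Γ₁) hsymm (hu z (hne z hz))
          (hu w (hne w hw)) h h'
        rw [hvec z hz, hvec w hw] at k2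
        have hFF : ∀ y, F (F y) = F y := fun y =>
          congrArg (fun B : K →L[ℂ] K => B y) hproj.idempotent
        have e1 := hproj.symmetric (gammaField A z₀ Γ z h) (gammaField A z₀ Γ w h')
        have e2 := hproj.symmetric (gammaField A z₀ Γ z h) (F (gammaField A z₀ Γ w h'))
        rw [hFF] at e2
        simp only [map_sub, sub_apply, inner_sub_right, one_apply_eq_self,
          KreinSymmetry.form_sub_left, KreinSymmetry.form_sub_right]
        rw [e2] at k2 ⊢
        rw [e1]
        linear_combination k1 - k2) hmax₂
      (fun m z h _ => by
        rw [SetLike.coe_subset_coe, Submodule.span_le]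
        rintro _ ⟨i, rfl⟩
        exact ⟨_, rfl⟩)
      (exists_hasNegDim_span hA hmin hQ.isOpen_domain hρ hDc hQ.domain_nonreal hFR' hn₂)
    exact
      { isOpen_domain := hQ.isOpen_domain
        analytic := fun z hz => (hQ.analytic z hz).sub (han z (hne z hz))
        domain_nonreal := hQ.domain_nonreal
        meromorphic := hQ.meromorphic.sub hmero
        domain_symm := hDc
        symm := fun z hz => by
          rw [map_sub, hQ.symm z hz, hadj z (hne z hz)]
        negSquares_le := hneg.1
        negSquares_eq := hneg.2 }

/-- By minimality, the range of `Γ₁` is not contained in the kernel of a power of `T - α` that does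
not vanish. -/
theorem exists_pow_pred_apply_ne_zero (hQ : IsGenNevanlinna D Q κ)
    (hrep : IsRepresentedBy D Q P A Γ z₀) (hmin : IsMinimal A Γ z₀)
    (hnd : P.NondegenerateOn S) (hE : ∀ (y : K) (s : S), P.form (E y) s = P.form y s)
    (hT : IsInducedOperator A S T) (hα : conj α = α) (hαD : α ∉ D) {l : ℕ} (hl : 0 < l)
    (hN : (T - α • (1 : S →L[ℂ] S)) ^ l = 0) {s : S}
    (hs : ((T - α • (1 : S →L[ℂ] S)) ^ (l - 1)) s ≠ 0) :
    ∃ h : H, ((T - α • (1 : S →L[ℂ] S)) ^ (l - 1))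
      (((T - z₀ • (1 : S →L[ℂ] S)) ∘L E ∘L Γ) h) ≠ 0 := by
  by_contra! hzero
  have hρ := hrep.domain_subset
  have hDc := hQ.domain_symm
  have hne : ∀ z ∈ D, z ≠ α := fun z hz h => hαD (h ▸ hz)
  have hconj : ∀ z : ℂ, z ≠ α → conj z ≠ α := fun z hz h => hz <| by
    rw [← Complex.conj_conj z, h, hα]
  set B : K →L[ℂ] S := ((T - α • (1 : S →L[ℂ] S)) ^ (l - 1)) ∘L E with hB
  have hle : (Submodule.span ℂ {y : K | ∃ z ∈ D, z.im ≠ 0 ∧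
      ∃ h : H, y = gammaField A z₀ Γ z h}).topologicalClosure ≤ LinearMap.ker B.toLinearMap := by
    refine Submodule.topologicalClosure_minimal _ ?_ B.isClosed_ker
    rw [Submodule.span_le]
    rintro _ ⟨z, hz, -, h, rfl⟩
    have hz' := hne z hz
    change B (gammaField A z₀ Γ z h) = 0
    have hu := isUnit_sub_smul_one ⟨l, hN⟩ hz'
    have h1 := proj_gammaField (z₀ := z₀) (Γ := Γ) hrep.isSelfAdjointRel hnd hE hT (hρ hz)
      (hρ (hDc z hz)) hu (isUnit_sub_smul_one ⟨l, hN⟩ (hconj z hz')) h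
    -- Since (T - z) E Γ_z = Γ₁, the left side is N^(l-1) Γ₁ h = 0 with N = T - α, and the factor α
    -- - z ≠ 0 cancels.
    have h2 := pow_pred_apply_sub hl hN z (E (gammaField A z₀ Γ z h))
    rw [← h1, ← mul_apply_eq_comp (T - z • (1 : S →L[ℂ] S)), Ring.mul_inverse_cancel _ hu,
      one_apply_eq_self, hzero, h1] at h2
    exact (smul_eq_zero.mp h2.symm).resolve_left (sub_ne_zero.mpr hz'.symm)
  rw [hmin.topologicalClosure_nonreal hQ.domain_nonreal] at hle
  apply hs
  have h3 : B s = 0 := hle (show (s : K) ∈ (⊤ : Submodule ℂ K) from trivial)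
  rwa [hB, ContinuousLinearMap.comp_apply, hnd.proj_apply_coe hE] at h3

end Decomposition

end

end GenNevanlinna


/-! ### Assembly of the decomposition and of the generated chains -/

theorem proposition3
    {H : Type*} [NormedAddCommGroup H] [InnerProductSpace ℂ H] [CompleteSpace H]
    {K : Type*} [NormedAddCommGroup K] [InnerProductSpace ℂ K] [CompleteSpace K]
    (P : GenNevanlinna.KreinSymmetry K) (A : Submodule ℂ (K × K)) (Γ : H →L[ℂ] K) (z₀ : ℂ)
    (D : Set ℂ) (Q : ℂ → H →L[ℂ] H) (κ : ℕ)
    (hQ : GenNevanlinna.IsGenNevanlinna D Q κ)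
    (hrep : GenNevanlinna.IsRepresentedBy D Q P A Γ z₀)
    (hmin : GenNevanlinna.IsMinimal A Γ z₀)
    (α : ℝ) (l : ℕ) (x : Fin l → K)
    (hx : GenNevanlinna.IsMaxNondegJordanChain P A (α : ℂ) x)
    (S : Submodule ℂ K) (hS : S = Submodule.span ℂ (Set.range x)) :
    -- the orthogonal projection `E` onto `S = span X`, the operator `A₁` induced by `A` in `S`,
    -- `G = E Γ` and `Γ₁ = (A₁ - z₀) E Γ`
    ∃ (E : K →L[ℂ] K) (A₁ : S →L[ℂ] S) (G Γ₁ : H →L[ℂ] S),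
      P.IsOrthogonalProjection S E ∧
      GenNevanlinna.IsInducedOperator A S A₁ ∧
      (∀ u v : S, P.form (A₁ u) v = P.form u (A₁ v)) ∧
      (∀ h : H, (G h : K) = E (Γ h)) ∧
      Γ₁ = (A₁ - z₀ • (1 : S →L[ℂ] S)) ∘L G ∧
      -- the decomposition of `Q`
      (∃ (Q₁ Q₂ : ℂ → H →L[ℂ] H) (κ₁ κ₂ : ℕ),
        GenNevanlinna.IsGenNevanlinna {(α : ℂ)}ᶜ Q₁ κ₁ ∧
        GenNevanlinna.IsGenNevanlinna D Q₂ κ₂ ∧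
        κ₁ + κ₂ = κ ∧
        (∀ z ∈ D, z ≠ (α : ℂ) ∧ Q z = Q₁ z + Q₂ z) ∧
        GenNevanlinna.sigma {(α : ℂ)}ᶜ Q₁ = {(α : ℂ)} ∧
        spectrum ℂ A₁ = {(α : ℂ)} ∧
        ∀ z : ℂ, z ≠ (α : ℂ) →
          Q₁ z = P.plusAdjointOn Γ₁ ∘L Ring.inverse (A₁ - z • (1 : S →L[ℂ] S)) ∘L Γ₁) ∧
      -- the chain generated by a vector in the range of `Γ₁`, and of `G = E Γ`
      (∃ v ∈ Set.range Γ₁,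
        GenNevanlinna.IsMaxNondegJordanChain P A (α : ℂ)
          (GenNevanlinna.jordanString A₁ (α : ℂ) l v) ∧
        Submodule.span ℂ (Set.range (GenNevanlinna.jordanString A₁ (α : ℂ) l v)) = S ∧
        ∀ k : Fin l, (k : ℕ) = 0 → GenNevanlinna.jordanString A₁ (α : ℂ) l v k = x k) ∧
      (∃ v ∈ Set.range G,
        GenNevanlinna.IsMaxNondegJordanChain P A (α : ℂ)
          (GenNevanlinna.jordanString A₁ (α : ℂ) l v) ∧
        Submodule.span ℂ (Set.range (GenNevanlinna.jordanString A₁ (α : ℂ) l v)) = S ∧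
        ∀ k : Fin l, (k : ℕ) = 0 → GenNevanlinna.jordanString A₁ (α : ℂ) l v k = x k) := by
  have hch := hx.isJordanChain
  have hl := hch.length_pos
  have hA := hrep.isSelfAdjointRel
  have hα : conj (α : ℂ) = α := Complex.conj_ofReal α
  have hnd : P.NondegenerateOn S := hS ▸ hx.nondegenerate
  have := GenNevanlinna.IsJordanChain.finiteDimensional hS
  obtain ⟨E, hE⟩ := GenNevanlinna.KreinSymmetry.exists_orthogonalProjection hnd
  obtain ⟨T, hT⟩ := hch.exists_isInducedOperator hA hnd hS
  let first : Fin l := ⟨0, hl⟩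
  have hfirst : (first : ℕ) = 0 := rfl
  have hlast : ((⟨l - 1, by omega⟩ : Fin l) : ℕ) + 1 = l := by simp only; omega
  have hx₀ := hch.eigenvector first hfirst
  have hX := hch.isNilpotentString hS hT
  have hN := hX.pow_length
  have hαD : (α : ℂ) ∉ D := fun h =>
    GenNevanlinna.notMem_relResolventSet hx₀.1 hx₀.2 (hrep.domain_subset h)
  have hX₀ : (⟨x first, hS ▸ Submodule.subset_span ⟨first, rfl⟩⟩ : S) ≠ 0 := fun h =>
    hx₀.1 (congrArg Subtype.val h)
  have hpow := hX.pow_pred_apply_last hfirst hlast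
  set Γ₁ : H →L[ℂ] S := (T - z₀ • (1 : S →L[ℂ] S)) ∘L E ∘L Γ with hΓ₁
  obtain ⟨h₀, hh₀⟩ := GenNevanlinna.exists_pow_pred_apply_ne_zero hQ hrep hmin hnd hE hT hα hαD hl
    hN (by rw [hpow]; exact hX₀)
  -- The range of (T - α)^(l-1) is the line ℂx₀, so a non-zero value on the range of Γ₁ can be
  -- rescaled to x₀ itself.
  obtain ⟨h₁, hh₁⟩ : ∃ h : H, ((T - (α : ℂ) • (1 : S →L[ℂ] S)) ^ (l - 1)) (Γ₁ h) =
      ⟨x first, hS ▸ Submodule.subset_span ⟨first, rfl⟩⟩ := by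
    obtain ⟨c, w, hcw⟩ := hX.exists_eq_smul_add hlast (Γ₁ h₀)
    have h2 := hX.pow_pred_apply hfirst hlast c w
    rw [← hcw] at h2
    have hc : c ≠ 0 := by
      rintro rfl
      exact hh₀ (by rw [h2, zero_smul])
    exact ⟨c⁻¹ • h₀, by rw [map_smul, map_smul, h2, smul_smul, inv_mul_cancel₀ hc, one_smul]⟩
  -- Under (T - α)^(l-1) the factor T - z₀ of Γ₁ acts as the scalar α - z₀, so this multiple of h₁
  -- serves for E Γ.
  have hh₂ : ((T - (α : ℂ) • (1 : S →L[ℂ] S)) ^ (l - 1)) ((E ∘L Γ) (((α : ℂ) - z₀) • h₁)) =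
      ⟨x first, hS ▸ Submodule.subset_span ⟨first, rfl⟩⟩ := by
    rw [map_smul, map_smul, ← GenNevanlinna.pow_pred_apply_sub hl hN]
    exact hh₁
  obtain ⟨κ₁, κ₂, hQ₁, hQ₂, hκ⟩ := GenNevanlinna.exists_decomposition hQ hrep hmin hnd hE hT hα hαD
    ⟨l, hN⟩ hΓ₁
  refine ⟨S.subtypeL ∘L E, T, E ∘L Γ, Γ₁,
    GenNevanlinna.KreinSymmetry.NondegenerateOn.isOrthogonalProjection hnd hE, hT, hT.symmetric hA, fun _ => rfl, rfl, ⟨GenNevanlinna.poleFunction P T Γ₁,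
      fun z => Q z - GenNevanlinna.poleFunction P T Γ₁ z, κ₁, κ₂, hQ₁, hQ₂, hκ, ?_, ?_, ?_,
      fun _ _ => rfl⟩,
    ⟨Γ₁ h₁, ⟨h₁, rfl⟩, hx.jordanString hS hT hfirst (congrArg Subtype.val hh₁)⟩,
    ⟨_, ⟨((α : ℂ) - z₀) • h₁, rfl⟩, hx.jordanString hS hT hfirst (congrArg Subtype.val hh₂)⟩⟩
  · exact fun z hz => ⟨fun h => hαD (h ▸ hz), (add_sub_cancel _ _).symm⟩
  · refine GenNevanlinna.sigma_poleFunction hl hN (h := h₁) (h' := h₁) ?_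
    rw [hh₁]
    exact hx.form_ne_zero hA hα hS hT hfirst (congrArg Subtype.val hh₁)
  · exact GenNevanlinna.spectrum_eq_singleton ⟨l, hN⟩ hX₀ (hX.apply_first first hfirst)
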